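/- A set $J\subseteq\mathbb Z^2$ is a diagram if $J+\mathbb N^2\subseteq J$, where $\mathbb N=\{0,1,2,\dots\}$; it is simple if it is a translate of one of $\mathbb Z^2$, $\mathbb Z_+^2$, $\mathbb Z_+\times\mathbb Z$, $\mathbb Z\times\mathbb Z_+$, where $\mathbb Z_+=\{1,2,\dots\}$. For a diagram $J$ let $H_J\subseteq L^2(\mathbb T^2)$ be the space of all $f$ with Fourier coefficients $\hat f_{i,j}=0$ for $(i,j)\notin J$, and let $M_w,M_z\in B(H_J)$ be the operators of multiplication by the coordinate functions $w,z$ of $\mathbb T^2$. The Taylor spectrum $\sigma_T(T_1,T_2)$ of a commuting pair of bounded operators on a Hilbert space $H$ is the set of $(\mu,\lambda)\in\mathbb C^2$ for which the Koszul complex $$0\to H\xrightarrow{\,h\mapsto(A h,\,B h)\,}H\oplus H\xrightarrow{\,(h_1,h_2)\mapsto -B h_1+A h_2\,}H\to 0,\qquad A=\mu-T_1,\ B=\lambda-T_2,$$ is not exact. For $j\in\mathbb Z$ let $M_j=\inf\{i\in\mathbb Z:(i,j)\in J\}\in\mathbb Z\cup\{-\infty,\infty\}$, with $\inf\emptyset=\infty$.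 If $M_j=\infty$ for some $j$, put $\rho_-=\delta_-=\infty$; otherwise $$\rho_-=\lim_{n\to\infty}\ \sup_{j\le 0,\ M_j\ne-\infty}\frac{M_{j-n}-M_j}{n},\qquad \delta_-=\lim_{n\to\infty}\ \inf_{j\le 0,\ M_j\ne-\infty}\frac{M_{j-n}-M_j}{n}.$$ If $M_j=-\infty$ for some $j$, put $\rho_+=\delta_+=\infty$; otherwise $$\rho_+=\lim_{n\to\infty}\ \sup_{j\ge -1,\ M_j\ne\infty}\frac{M_j-M_{j+n}}{n},\qquad \delta_+=\lim_{n\to\infty}\ \inf_{j\ge -1,\ M_j\ne\infty}\frac{M_j-M_{j+n}}{n}.$$ Theorem. Let $J$ be a non-empty, non-simple diagram. Then the limits above exist in $[0,\infty]$ in the cases in which they are used, and $$\sigma_T(M_w,M_z)=\{(\mu,\lambda)\in\overline{\mathbb D}^2:\ |\mu|^{\max(\rho_-,\rho_+)}\le|\lambda|\le|\mu|^{\min(\delta_-,\delta_+)}\},$$ where $a^\infty=0$ for $0\le a<1$, and an inequality in which the power has the form $0^0$ or $1^\infty$ is counted as satisfied. -/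

import Mathlib

open Filter Topology MeasureTheory Set

noncomputable section

/-! ### Taylor spectrum of a pair of operators -/

section Taylor

variable {H : Type*} [NormedAddCommGroup H] [NormedSpace ℂ H]

/-- First map of the Koszul complex `0 → H → H ⊕ H → H → 0` of a pair: `h ↦ (T₁ h, T₂ h)`. -/
def koszulOne (T₁ T₂ : H →L[ℂ] H) : H →L[ℂ] H × H := T₁.prod T₂

/-- Second map of the Koszul complex of a pair: `(h₁, h₂) ↦ -T₂ h₁ + T₁ h₂`. -/
def koszulTwo (T₁ T₂ : H →L[ℂ] H) : H × H →L[ℂ] H := (-T₂).coprod T₁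

/-- Exactness of the Koszul complex `0 → H → H ⊕ H → H → 0` at each of its three places. -/
def KoszulExact (T₁ T₂ : H →L[ℂ] H) : Prop :=
  (koszulOne T₁ T₂).ker = ⊥ ∧
    (koszulTwo T₁ T₂).ker = (koszulOne T₁ T₂).range ∧
    (koszulTwo T₁ T₂).range = ⊤

/-- The Taylor spectrum of a commuting pair of bounded operators: the pairs `(μ, λ)` for which the
Koszul complex of `(μ - T₁, λ - T₂)` is not exact. -/
def taylorSpectrum (T₁ T₂ : H →L[ℂ] H) (_ : Commute T₁ T₂) : Set (ℂ × ℂ) :=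
  {p | ¬ KoszulExact (p.1 • ContinuousLinearMap.id ℂ H - T₁)
    (p.2 • ContinuousLinearMap.id ℂ H - T₂)}

end Taylor

/-! ### Diagrams -/

/-- A diagram: a set `J ⊆ ℤ²` with `J + ℕ² ⊆ J`. -/
def IsDiagram (J : Set (ℤ × ℤ)) : Prop :=
  ∀ i j : ℤ, (i, j) ∈ J → ∀ k l : ℕ, (i + k, j + l) ∈ J

/-- Translation equivalence of subsets of `ℤ²`. -/
def DiagramEquiv (J₁ J₂ : Set (ℤ × ℤ)) : Prop :=
  ∃ v : ℤ × ℤ, J₁ = (fun x => v + x) '' J₂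

/-- A diagram is simple if it is a translate of `ℤ²`, `ℤ₊²`, `ℤ₊ × ℤ` or `ℤ × ℤ₊`,
where `ℤ₊ = {1, 2, …}`. -/
def IsSimpleDiagram (J : Set (ℤ × ℤ)) : Prop :=
  DiagramEquiv J (univ ×ˢ univ) ∨ DiagramEquiv J (Ioi 0 ×ˢ Ioi 0) ∨
    DiagramEquiv J (Ioi 0 ×ˢ univ) ∨ DiagramEquiv J (univ ×ˢ Ioi 0)

/-- The border sequence `M_j = inf {i : (i, j) ∈ J} ∈ ℤ ∪ {-∞, ∞}`; it is `∞` if the row is empty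
and `-∞` if the row is all of `ℤ`. -/
def border (J : Set (ℤ × ℤ)) (j : ℤ) : EReal :=
  ⨅ (i : ℤ) (_ : (i, j) ∈ J), ((i : ℝ) : EReal)

/-! ### The space `H_J` and the multiplication operators -/

-- Mathlib's probability Haar measure on `ℝ/ℤ`, as used in its Fourier theory on the torus.
attribute [local instance] instMeasureSpaceUnitAddCircle

/-- `L²(𝕋²)`; a point `x` of the torus `(ℝ/ℤ)²` stands for `(w, z) = (e^{2πi x₀}, e^{2πi x₁})`,
and `volume` is the normalized Haar measure. -/
abbrev L2Torus : Type := Lp ℂ 2 (volume : Measure (UnitAddTorus (Fin 2)))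

/-- Multiplication by the monomial `w ^ (n 0) * z ^ (n 1)` on `L²(𝕋²)`. -/
def mulMonomial (n : Fin 2 → ℤ) : L2Torus →L[ℂ] L2Torus :=
  (ContinuousLinearMap.mul ℂ ℂ).holderL volume ⊤ 2 2 (UnitAddTorus.mFourierLp ⊤ n)

theorem mulMonomial_coeFn (n : Fin 2 → ℤ) (f : L2Torus) :
    ⇑(mulMonomial n f) =ᵐ[volume] fun x => UnitAddTorus.mFourier n x * f x := by
  filter_upwards [(ContinuousLinearMap.mul ℂ ℂ).coeFn_holder (r := 2)
    (UnitAddTorus.mFourierLp ⊤ n) f, UnitAddTorus.coeFn_mFourierLp ⊤ n] with x h₁ h₂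
  rw [← h₂]
  exact h₁

theorem mFourierCoeff_mulMonomial (n m : Fin 2 → ℤ) (f : L2Torus) :
    UnitAddTorus.mFourierCoeff (mulMonomial n f) m = UnitAddTorus.mFourierCoeff f (m - n) := by
  unfold UnitAddTorus.mFourierCoeff
  refine integral_congr_ae ?_
  filter_upwards [mulMonomial_coeFn n f] with x hx
  simp only [hx, smul_eq_mul]
  rw [← mul_assoc, ← UnitAddTorus.mFourier_add, neg_sub, neg_add_eq_sub]

/-- `H_J`: the functions in `L²(𝕋²)` whose Fourier coefficients vanish outside `J`. -/
def HJ (J : Set (ℤ × ℤ)) : Submodule ℂ L2Torus where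
  carrier := {f | ∀ i j : ℤ, (i, j) ∉ J → UnitAddTorus.mFourierCoeff f ![i, j] = 0}
  zero_mem' := fun i j _ => by
    rw [← UnitAddTorus.mFourierBasis_repr, map_zero]; rfl
  add_mem' := fun {f g} hf hg i j h => by
    rw [← UnitAddTorus.mFourierBasis_repr, map_add, lp.coeFn_add, Pi.add_apply,
      UnitAddTorus.mFourierBasis_repr, UnitAddTorus.mFourierBasis_repr, hf i j h, hg i j h,
      add_zero]
  smul_mem' := fun c f hf i j h => by
    rw [← UnitAddTorus.mFourierBasis_repr, map_smul, lp.coeFn_smul, Pi.smul_apply,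
      UnitAddTorus.mFourierBasis_repr, hf i j h, smul_zero]

theorem mulMonomial_mem_HJ {J : Set (ℤ × ℤ)} (hJ : IsDiagram J) (k l : ℕ) {f : L2Torus}
    (hf : f ∈ HJ J) : mulMonomial ![(k : ℤ), (l : ℤ)] f ∈ HJ J := by
  intro i j hij
  rw [mFourierCoeff_mulMonomial]
  have h : (![i, j] - ![(k : ℤ), (l : ℤ)] : Fin 2 → ℤ) = ![i - k, j - l] := by
    ext a; fin_cases a <;> rfl
  rw [h]
  refine hf _ _ fun hmem => hij ?_
  simpa using hJ _ _ hmem k l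

/-- The operator `M_w` on `H_J`: multiplication by the first coordinate `w`. -/
def Mw {J : Set (ℤ × ℤ)} (hJ : IsDiagram J) : HJ J →L[ℂ] HJ J :=
  ((mulMonomial ![1, 0]).comp (HJ J).subtypeL).codRestrict (HJ J)
    fun f => mulMonomial_mem_HJ hJ 1 0 f.2

/-- The operator `M_z` on `H_J`: multiplication by the second coordinate `z`. -/
def Mz {J : Set (ℤ × ℤ)} (hJ : IsDiagram J) : HJ J →L[ℂ] HJ J :=
  ((mulMonomial ![0, 1]).comp (HJ J).subtypeL).codRestrict (HJ J)
    fun f => mulMonomial_mem_HJ hJ 0 1 f.2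

theorem commute_Mw_Mz {J : Set (ℤ × ℤ)} (hJ : IsDiagram J) : Commute (Mw hJ) (Mz hJ) := by
  refine ContinuousLinearMap.ext fun f => Subtype.ext (Lp.ext ?_)
  change ⇑(mulMonomial ![1, 0] (mulMonomial ![0, 1] (f : L2Torus))) =ᵐ[volume]
    ⇑(mulMonomial ![0, 1] (mulMonomial ![1, 0] (f : L2Torus)))
  filter_upwards [mulMonomial_coeFn ![1, 0] (mulMonomial ![0, 1] (f : L2Torus)),
    mulMonomial_coeFn ![0, 1] (mulMonomial ![1, 0] (f : L2Torus)),
    mulMonomial_coeFn ![1, 0] (f : L2Torus), mulMonomial_coeFn ![0, 1] (f : L2Torus)]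
    with x h₁ h₂ h₃ h₄
  rw [h₁, h₂, h₃, h₄]
  ring

/-! ### The parameters of a diagram -/

/-- `sup_j (M_{j-n} - M_j) / n`, over the rows `j ≤ 0` with `M_j ≠ -∞`. -/
def supSlopeMinus (J : Set (ℤ × ℤ)) (n : ℕ) : EReal :=
  ⨆ (j : ℤ) (_ : j ≤ 0 ∧ border J j ≠ ⊥), (border J (j - n) - border J j) / (n : EReal)

/-- `inf_j (M_{j-n} - M_j) / n`, over the rows `j ≤ 0` with `M_j ≠ -∞`. -/
def infSlopeMinus (J : Set (ℤ × ℤ)) (n : ℕ) : EReal :=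
  ⨅ (j : ℤ) (_ : j ≤ 0 ∧ border J j ≠ ⊥), (border J (j - n) - border J j) / (n : EReal)

/-- `sup_j (M_j - M_{j+n}) / n`, over the rows `j ≥ -1` with `M_j ≠ ∞`. -/
def supSlopePlus (J : Set (ℤ × ℤ)) (n : ℕ) : EReal :=
  ⨆ (j : ℤ) (_ : -1 ≤ j ∧ border J j ≠ ⊤), (border J j - border J (j + n)) / (n : EReal)

/-- `inf_j (M_j - M_{j+n}) / n`, over the rows `j ≥ -1` with `M_j ≠ ∞`. -/
def infSlopePlus (J : Set (ℤ × ℤ)) (n : ℕ) : EReal :=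
  ⨅ (j : ℤ) (_ : -1 ≤ j ∧ border J j ≠ ⊤), (border J j - border J (j + n)) / (n : EReal)

open Classical in
/-- `ρ₋`: it is `∞` if some `M_j = ∞`, and `lim_n sup_j (M_{j-n} - M_j) / n` otherwise. -/
def rhoMinus (J : Set (ℤ × ℤ)) : EReal :=
  if ∃ j, border J j = ⊤ then ⊤ else limUnder atTop (supSlopeMinus J)

open Classical in
/-- `δ₋`: it is `∞` if some `M_j = ∞`, and `lim_n inf_j (M_{j-n} - M_j) / n` otherwise. -/
def deltaMinus (J : Set (ℤ × ℤ)) : EReal :=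
  if ∃ j, border J j = ⊤ then ⊤ else limUnder atTop (infSlopeMinus J)

open Classical in
/-- `ρ₊`: it is `∞` if some `M_j = -∞`, and `lim_n sup_j (M_j - M_{j+n}) / n` otherwise. -/
def rhoPlus (J : Set (ℤ × ℤ)) : EReal :=
  if ∃ j, border J j = ⊥ then ⊤ else limUnder atTop (supSlopePlus J)

open Classical in
/-- `δ₊`: it is `∞` if some `M_j = -∞`, and `lim_n inf_j (M_j - M_{j+n}) / n` otherwise. -/
def deltaPlus (J : Set (ℤ × ℤ)) : EReal :=
  if ∃ j, border J j = ⊥ then ⊤ else limUnder atTop (infSlopePlus J)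

/-! ### Powers with exponent in `[0, ∞]` -/

/-- `a ^ p` for `a ∈ [0, 1]` and `p ∈ [0, ∞]`, with `a ^ ∞ = 0` for `a < 1`; the indeterminate
forms `0 ^ 0` and `1 ^ ∞` are treated separately, their value here being irrelevant. -/
def extPow (a : ℝ) (p : EReal) : ℝ :=
  if p = ⊤ then 0 else a ^ p.toReal

/-- `a ^ p` is one of the indeterminate forms `0 ^ 0`, `1 ^ ∞`. -/
def IsIndeterminate (a : ℝ) (p : EReal) : Prop :=
  (a = 0 ∧ p = 0) ∨ (a = 1 ∧ p = ⊤)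

/-- The inequality `a ^ p ≤ b`, counted as satisfied if `a ^ p` is `0 ^ 0` or `1 ^ ∞`. -/
def PowLE (a : ℝ) (p : EReal) (b : ℝ) : Prop :=
  IsIndeterminate a p ∨ extPow a p ≤ b

/-- The inequality `b ≤ a ^ p`, counted as satisfied if `a ^ p` is `0 ^ 0` or `1 ^ ∞`. -/
def LEPow (b a : ℝ) (p : EReal) : Prop :=
  IsIndeterminate a p ∨ b ≤ extPow a p

end

/-! Exactness off the set comes from monomials. If J + (p, q) ⊆ J, then multiplication by w^p z^q is
a contraction V of H_J that commutes with M_w and M_z. If J + (-b, n) ⊆ J, then M_z^n = M_w^b V, so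
λ^n - μ^b V = (λ^n - M_z^n) - (μ^b - M_w^b) V. The left side is invertible when |μ|^b < |λ|^n, and
the right side is a combination of λ - M_z and μ - M_w. This is a Bezout identity, which makes the
Koszul complex exact (`exists_bezout_of_pow_eq`). Shifts (a, -n) serve in the same way when |λ|^n <
|μ|^a. A Fekete argument tells which shifts exist: b ≈ rn for 0 ≤ r < min(δ₋, δ₊) and a ≈ rn for r >
max(ρ₋, ρ₊), up to a bounded error that large n absorbs (`IsBorder.of_lt_delta`,
`IsBorder.of_rho_lt`).

For |μ| < 1, evaluating the half-line rows of J at w = μ annihilates the range of μ - M_w and turns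
M_z into a weighted shift W on ℓ²(F), where F is the set of half-line rows and the weights are
μ^(M_j - M_{j+1}). Exactness makes λ - W injective and uniformly solvable on unit vectors. This
forces |λ|^n to lie above all, or below all, products of n consecutive weights, for some n
(`weightedShift_dichotomy`). The first alternative contradicts the inequality with δ, the second the
one with ρ; here simple diagrams have to be excluded.

For |μ| = 1, polynomials supported on large rectangles in J are approximate joint eigenvectors of
the adjoints, which rules out surjectivity at the last place (`KoszulExactAt.exists_window_bound`).
When |λ| < 1 the rectangle must rest on a long horizontal edge of J, so that nothing enters from
below; ρ = ∞ supplies such edges (`IsBorder.exists_long_edge`). -/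

noncomputable section

/-! ### Exactness of the Koszul complex -/

section Koszul

variable {H : Type*} [NormedAddCommGroup H] [NormedSpace ℂ H]

/-- A pair for which `A C + B D = 1` is solvable in its commutant has an exact Koszul complex. -/
theorem koszulExact_of_bezout {A B C D : H →L[ℂ] H} (hAB : Commute A B) (hAC : Commute A C)
    (hAD : Commute A D) (hBC : Commute B C) (hBD : Commute B D) (h : A * C + B * D = 1) :
    KoszulExact A B := by
  have e (x : H) : A (C x) + B (D x) = x := by
    simpa using congrArg (fun T : H →L[ℂ] H => T x) h
  have c {S T : H →L[ℂ] H} (h : Commute S T) (x : H) : S (T x) = T (S x) :=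
    congrArg (fun T : H →L[ℂ] H => T x) h.eq
  refine ⟨?_, ?_, ?_⟩
  · rw [LinearMap.ker_eq_bot']
    intro x hx
    obtain ⟨h1, h2⟩ : A x = 0 ∧ B x = 0 := by simpa [koszulOne] using hx
    rw [← e x, c hAC, c hBD, h1, h2]; simp
  · apply le_antisymm
    · rintro ⟨x, y⟩ hx
      have hx' : A y = B x := by
        have : -(B x) + A y = 0 := by simpa [koszulTwo] using hx
        exact (neg_add_eq_zero.mp this).symm
      refine ⟨C x + D y, ?_⟩
      have h1 : A (C x + D y) = x := by rw [map_add, c hAD, hx', ← c hBD, e]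
      have h2 : B (C x + D y) = y := by rw [map_add, c hBC, ← hx', ← c hAC, e]
      exact Prod.ext h1 h2
    · rintro _ ⟨x, rfl⟩
      have : -(B (A x)) + A (B x) = 0 := by rw [c hAB]; simp
      simpa [koszulTwo, koszulOne] using this
  · rw [LinearMap.range_eq_top]
    intro y
    refine ⟨(-D y, C y), ?_⟩
    simp only [koszulTwo, ContinuousLinearMap.coe_coe, ContinuousLinearMap.coprod_apply, map_neg,
      neg_apply, neg_neg]
    rw [add_comm]; exact e y

/-- The open mapping theorem makes surjectivity quantitative. The uniform constant is what the
non-exactness arguments contradict. -/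
theorem KoszulExact.exists_preimage [CompleteSpace H] {A B : H →L[ℂ] H} (h : KoszulExact A B) :
    ∃ C > 0, ∀ y, ∃ f g : H, A g - B f = y ∧ ‖f‖ ≤ C * ‖y‖ ∧ ‖g‖ ≤ C * ‖y‖ := by
  obtain ⟨C, hC, hs⟩ := (koszulTwo A B).exists_preimage_norm_le (LinearMap.range_eq_top.mp h.2.2)
  refine ⟨C, hC, fun y => ?_⟩
  obtain ⟨⟨f, g⟩, h1, h2⟩ := hs y
  refine ⟨f, g, ?_, (norm_fst_le _).trans h2, (norm_snd_le _).trans h2⟩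
  rw [← h1]; simp [koszulTwo]; abel

theorem KoszulExact.exists_of_eq {A B : H →L[ℂ] H} (h : KoszulExact A B) {f g : H}
    (hfg : B f = A g) : ∃ x, A x = f ∧ B x = g := by
  have : (f, g) ∈ (koszulTwo A B).ker := by
    have : -(B f) + A g = 0 := by rw [hfg]; simp
    simpa [koszulTwo] using this
  rw [h.2.1] at this
  obtain ⟨x, hx⟩ := this
  exact ⟨x, congrArg Prod.fst hx, congrArg Prod.snd hx⟩

/-- Both differences in (λ^n - T^n) - (μ^b - S^b) V = λ^n - μ^b V factor as geometric sums, and the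
right side is invertible. The coefficients are built from S, T, V alone, so they commute with
whatever commutes with these. -/
theorem exists_bezout_of_pow_eq [CompleteSpace H] {S T V : H →L[ℂ] H} (hV : ‖V‖ ≤ 1) {b n : ℕ}
    (h : T ^ n = S ^ b * V) {μ lam : ℂ} (hlt : ‖μ‖ ^ b < ‖lam‖ ^ n) :
    ∃ C D : H →L[ℂ] H, (∀ R, Commute R S → Commute R T → Commute R V → Commute R C ∧ Commute R D) ∧
      (μ • ContinuousLinearMap.id ℂ H - S) * C + (lam • ContinuousLinearMap.id ℂ H - T) * D = 1 := by
  have hid : ContinuousLinearMap.id ℂ H = 1 := rfl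
  simp only [hid]
  have hunit : IsUnit (algebraMap ℂ (H →L[ℂ] H) (lam ^ n) - μ ^ b • V) := by
    -- The norm of the identity stays as a factor because it is 0 on the zero space.
    refine spectrum.mem_resolventSet_of_norm_lt_mul (lt_of_le_of_lt ?_ (by rwa [norm_pow]))
    rw [norm_smul, norm_pow]
    calc ‖μ‖ ^ b * ‖V‖ * ‖(1 : H →L[ℂ] H)‖ ≤ ‖μ‖ ^ b * 1 * 1 := by
          gcongr; exact ContinuousLinearMap.norm_id_le
      _ = ‖μ‖ ^ b := by ring
  obtain ⟨X, hX⟩ := hunit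
  set P := ∑ i ∈ Finset.range n, (lam • (1 : H →L[ℂ] H)) ^ i * T ^ (n - 1 - i) with hP
  set Q := ∑ i ∈ Finset.range b, (μ • (1 : H →L[ℂ] H)) ^ i * S ^ (b - 1 - i) with hQ
  have cs (c : ℂ) (R : H →L[ℂ] H) : Commute R (c • (1 : H →L[ℂ] H)) :=
    (Commute.one_right R).smul_right c
  have eP : (lam • (1 : H →L[ℂ] H) - T) * P = lam ^ n • 1 - T ^ n := by
    rw [hP, (cs lam T).symm.mul_geom_sum₂, smul_pow, one_pow]
  have eQ : (μ • (1 : H →L[ℂ] H) - S) * Q = μ ^ b • 1 - S ^ b := by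
    rw [hQ, (cs μ S).symm.mul_geom_sum₂, smul_pow, one_pow]
  refine ⟨-(Q * V * ↑X⁻¹), P * ↑X⁻¹, fun R hS hT hV => ?_, ?_⟩
  · have hRX : Commute R (X : H →L[ℂ] H) := by
      rw [hX, Algebra.algebraMap_eq_smul_one]
      exact (cs _ R).sub_right (hV.smul_right _)
    have hRX' := hRX.units_inv_right
    have hRP : Commute R P := Commute.sum_right _ _ _ fun i _ =>
      ((cs _ R).pow_right _).mul_right (hT.pow_right _)
    have hRQ : Commute R Q := Commute.sum_right _ _ _ fun i _ =>
      ((cs _ R).pow_right _).mul_right (hS.pow_right _)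
    exact ⟨((hRQ.mul_right hV).mul_right hRX').neg_right, hRP.mul_right hRX'⟩
  · have : (μ • (1 : H →L[ℂ] H) - S) * -(Q * V * ↑X⁻¹) + (lam • (1 : H →L[ℂ] H) - T) * (P * ↑X⁻¹)
        = ((lam • (1 : H →L[ℂ] H) - T) * P - (μ • (1 : H →L[ℂ] H) - S) * Q * V) * ↑X⁻¹ := by
      noncomm_ring
    rw [this, eP, eQ, h, sub_mul (μ ^ b • 1), smul_mul_assoc, one_mul, sub_sub_sub_cancel_right,
      ← Algebra.algebraMap_eq_smul_one, ← hX, Units.mul_inv]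

theorem commute_smul_id_sub {S R : H →L[ℂ] H} (c : ℂ) (h : Commute S R) :
    Commute (c • ContinuousLinearMap.id ℂ H - S) R :=
  ((Commute.one_left R).smul_left c).sub_left h

theorem koszulExact_of_pow_eq_left [CompleteSpace H] {S T V : H →L[ℂ] H} (hST : Commute S T)
    (hSV : Commute S V) (hTV : Commute T V) (hV : ‖V‖ ≤ 1) {b n : ℕ} (h : T ^ n = S ^ b * V)
    {μ lam : ℂ} (hlt : ‖μ‖ ^ b < ‖lam‖ ^ n) :
    KoszulExact (μ • ContinuousLinearMap.id ℂ H - S) (lam • ContinuousLinearMap.id ℂ H - T) := by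
  obtain ⟨C, D, hc, he⟩ := exists_bezout_of_pow_eq hV h hlt
  have h1 := hc S (Commute.refl _) hST hSV
  have h2 := hc T hST.symm (Commute.refl _) hTV
  exact koszulExact_of_bezout (commute_smul_id_sub _ (commute_smul_id_sub _ hST.symm).symm)
    (commute_smul_id_sub _ h1.1) (commute_smul_id_sub _ h1.2) (commute_smul_id_sub _ h2.1)
    (commute_smul_id_sub _ h2.2) he

theorem koszulExact_of_pow_eq_right [CompleteSpace H] {S T V : H →L[ℂ] H} (hST : Commute S T)
    (hSV : Commute S V) (hTV : Commute T V) (hV : ‖V‖ ≤ 1) {a n : ℕ} (h : S ^ a = T ^ n * V)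
    {μ lam : ℂ} (hlt : ‖lam‖ ^ n < ‖μ‖ ^ a) :
    KoszulExact (μ • ContinuousLinearMap.id ℂ H - S) (lam • ContinuousLinearMap.id ℂ H - T) := by
  obtain ⟨C, D, hc, he⟩ := exists_bezout_of_pow_eq hV h hlt
  have h1 := hc S hST (Commute.refl _) hSV
  have h2 := hc T (Commute.refl _) hST.symm hTV
  exact koszulExact_of_bezout (commute_smul_id_sub _ (commute_smul_id_sub _ hST.symm).symm)
    (commute_smul_id_sub _ h1.2) (commute_smul_id_sub _ h1.1) (commute_smul_id_sub _ h2.2)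
    (commute_smul_id_sub _ h2.1) (by rw [add_comm]; exact he)

end Koszul

/-! ### Fourier coefficients on `H_J` -/

section Coefficients

open UnitAddTorus

attribute [local instance] instMeasureSpaceUnitAddCircle

variable {J : Set (ℤ × ℤ)}

/-- The `(i, j)`-th Fourier coefficient, as a continuous functional on `L²(𝕋²)`. -/
def coeffL (i j : ℤ) : L2Torus →L[ℂ] ℂ :=
  (lp.evalCLM ℂ (fun _ : Fin 2 → ℤ => ℂ) 2 ![i, j]).comp
    (mFourierBasis (d := Fin 2)).repr.toContinuousLinearEquiv.toContinuousLinearMap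

theorem coeffL_apply (i j : ℤ) (f : L2Torus) : coeffL i j f = mFourierCoeff f ![i, j] := by
  rw [← mFourierBasis_repr]; rfl

instance completeSpace_HJ : CompleteSpace (HJ J) := by
  have : IsClosed (HJ J : Set L2Torus) := by
    have : (HJ J : Set L2Torus) = ⋂ (i : ℤ) (j : ℤ) (_ : (i, j) ∉ J), {f | coeffL i j f = 0} := by
      ext f
      simp only [mem_iInter, mem_ofPred_eq, coeffL_apply]
      rfl
    rw [this]
    exact isClosed_iInter fun i => isClosed_iInter fun j => isClosed_iInter fun _ =>
      isClosed_eq (coeffL i j).continuous continuous_const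
  exact this.completeSpace_coe

/-- The Fourier coefficients of an element of `H_J`. -/
def cf (f : HJ J) (i j : ℤ) : ℂ := coeffL i j f

@[simp] theorem cf_sub (f g : HJ J) (i j : ℤ) : cf (f - g) i j = cf f i j - cf g i j := by
  simp [cf]

@[simp] theorem cf_smul (c : ℂ) (f : HJ J) (i j : ℤ) : cf (c • f) i j = c * cf f i j := by
  simp [cf]

theorem cf_eq_zero (f : HJ J) {i j : ℤ} (h : (i, j) ∉ J) : cf f i j = 0 := by
  rw [cf, coeffL_apply]; exact f.2 i j h

theorem hasSum_norm_cf_sq (f : HJ J) :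
    HasSum (fun x : ℤ × ℤ => ‖cf f x.1 x.2‖ ^ 2) (‖f‖ ^ 2) := by
  have h := lp.hasSum_norm (p := 2) (by norm_num) ((mFourierBasis (d := Fin 2)).repr (f : L2Torus))
  rw [← (finTwoArrowEquiv ℤ).symm.hasSum_iff] at h
  simp only [ENNReal.toReal_ofNat, Real.rpow_two, LinearIsometryEquiv.norm_map] at h
  exact h

theorem summable_norm_cf_sq (f : HJ J) : Summable fun x : ℤ × ℤ => ‖cf f x.1 x.2‖ ^ 2 :=
  (hasSum_norm_cf_sq f).summable

theorem cf_ext {f g : HJ J} (h : ∀ i j, cf f i j = cf g i j) : f = g := by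
  have h0 := hasSum_norm_cf_sq (f - g)
  simp only [cf_sub, h, sub_self, norm_zero, ne_eq, OfNat.ofNat_ne_zero, not_false_eq_true,
    zero_pow] at h0
  have := h0.unique hasSum_zero
  rwa [sq_eq_zero_iff, norm_eq_zero, sub_eq_zero] at this

theorem exists_cf_eq {c : ℤ → ℤ → ℂ} (hs : Summable fun x : ℤ × ℤ => ‖c x.1 x.2‖ ^ 2)
    (h0 : ∀ i j, (i, j) ∉ J → c i j = 0) : ∃ f : HJ J, ∀ i j, cf f i j = c i j := by
  have hm : Memℓp (fun n : Fin 2 → ℤ => c (n 0) (n 1)) 2 := by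
    refine memℓp_gen ?_
    rw [← (finTwoArrowEquiv ℤ).symm.summable_iff]
    simpa [Function.comp_def] using hs
  set F := (mFourierBasis (d := Fin 2)).repr.symm ⟨_, hm⟩ with hF
  have hc (i j : ℤ) : coeffL i j F = c i j := by
    rw [coeffL_apply, ← mFourierBasis_repr, hF, LinearIsometryEquiv.apply_symm_apply]; rfl
  refine ⟨⟨F, fun i j hij => ?_⟩, hc⟩
  rw [← coeffL_apply, hc, h0 i j hij]

/-! ### Monomial multipliers, possibly with negative exponents, and the exactness they give -/

theorem mulMonomial_mem_HJ_of_shift {p q : ℤ} (h : ∀ i j, (i, j) ∈ J → (i + p, j + q) ∈ J)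
    {f : L2Torus} (hf : f ∈ HJ J) : mulMonomial ![p, q] f ∈ HJ J := by
  intro i j hij
  rw [mFourierCoeff_mulMonomial]
  have h' : (![i, j] - ![p, q] : Fin 2 → ℤ) = ![i - p, j - q] := by
    ext a; fin_cases a <;> rfl
  rw [h']
  refine hf _ _ fun hmem => hij ?_
  simpa using h _ _ hmem

/-- Multiplication by the monomial `w ^ p z ^ q` on `H_J`, when `J + (p, q) ⊆ J`. -/
def shiftHJ {p q : ℤ} (h : ∀ i j, (i, j) ∈ J → (i + p, j + q) ∈ J) : HJ J →L[ℂ] HJ J :=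
  ((mulMonomial ![p, q]).comp (HJ J).subtypeL).codRestrict (HJ J)
    fun f => mulMonomial_mem_HJ_of_shift h f.2

theorem coeffL_mulMonomial (p q i j : ℤ) (f : L2Torus) :
    coeffL i j (mulMonomial ![p, q] f) = coeffL (i - p) (j - q) f := by
  rw [coeffL_apply, coeffL_apply, mFourierCoeff_mulMonomial]
  congr 1; ext a; fin_cases a <;> rfl

@[simp] theorem cf_shiftHJ {p q : ℤ} (h : ∀ i j, (i, j) ∈ J → (i + p, j + q) ∈ J) (f : HJ J)
    (i j : ℤ) : cf (shiftHJ h f) i j = cf f (i - p) (j - q) :=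
  coeffL_mulMonomial p q i j f

@[simp] theorem cf_Mw (hJ : IsDiagram J) (f : HJ J) (i j : ℤ) :
    cf (Mw hJ f) i j = cf f (i - 1) j :=
  (coeffL_mulMonomial 1 0 i j (f : L2Torus)).trans (by rw [sub_zero]; rfl)

@[simp] theorem cf_Mz (hJ : IsDiagram J) (f : HJ J) (i j : ℤ) :
    cf (Mz hJ f) i j = cf f i (j - 1) :=
  (coeffL_mulMonomial 0 1 i j (f : L2Torus)).trans (by rw [sub_zero]; rfl)

theorem norm_shiftHJ_le {p q : ℤ} (h : ∀ i j, (i, j) ∈ J → (i + p, j + q) ∈ J) :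
    ‖shiftHJ h‖ ≤ 1 := by
  refine ContinuousLinearMap.opNorm_le_bound _ zero_le_one fun f => ?_
  have h1 := hasSum_norm_cf_sq (shiftHJ h f)
  have h2 := hasSum_norm_cf_sq f
  rw [← (Equiv.subRight ((p, q) : ℤ × ℤ)).hasSum_iff] at h2
  simp only [cf_shiftHJ] at h1
  have := h1.unique h2
  rw [one_mul]
  exact ((sq_eq_sq₀ (norm_nonneg _) (norm_nonneg _)).mp this).le

theorem cf_Mw_pow (hJ : IsDiagram J) (n : ℕ) (f : HJ J) (i j : ℤ) :
    cf ((Mw hJ ^ n) f) i j = cf f (i - n) j := by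
  induction n generalizing i with
  | zero => simp
  | succ n ih =>
    rw [pow_succ', mul_apply_eq_comp, cf_Mw, ih]; push_cast; congr 1; ring

theorem cf_Mz_pow (hJ : IsDiagram J) (n : ℕ) (f : HJ J) (i j : ℤ) :
    cf ((Mz hJ ^ n) f) i j = cf f i (j - n) := by
  induction n generalizing j with
  | zero => simp
  | succ n ih =>
    rw [pow_succ', mul_apply_eq_comp, cf_Mz, ih]; push_cast; congr 1; ring

theorem commute_Mw_shiftHJ (hJ : IsDiagram J) {p q : ℤ}
    (h : ∀ i j, (i, j) ∈ J → (i + p, j + q) ∈ J) : Commute (Mw hJ) (shiftHJ h) :=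
  ContinuousLinearMap.ext fun f => cf_ext fun i j => by
    simp only [mul_apply_eq_comp, cf_Mw, cf_shiftHJ]; congr 1; ring

theorem commute_Mz_shiftHJ (hJ : IsDiagram J) {p q : ℤ}
    (h : ∀ i j, (i, j) ∈ J → (i + p, j + q) ∈ J) : Commute (Mz hJ) (shiftHJ h) :=
  ContinuousLinearMap.ext fun f => cf_ext fun i j => by
    simp only [mul_apply_eq_comp, cf_Mz, cf_shiftHJ]; congr 1; ring

/-- The contraction is V = w^(-b) z^n, for which M_z^n = M_w^b V. -/
theorem koszulExact_of_shift_left (hJ : IsDiagram J) {b n : ℕ}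
    (h : ∀ i j, (i, j) ∈ J → (i + -(b : ℤ), j + (n : ℤ)) ∈ J) {μ lam : ℂ}
    (hlt : ‖μ‖ ^ b < ‖lam‖ ^ n) :
    KoszulExact (μ • ContinuousLinearMap.id ℂ (HJ J) - Mw hJ)
      (lam • ContinuousLinearMap.id ℂ (HJ J) - Mz hJ) := by
  refine koszulExact_of_pow_eq_left (commute_Mw_Mz hJ) (commute_Mw_shiftHJ hJ h)
    (commute_Mz_shiftHJ hJ h) (norm_shiftHJ_le h) ?_ hlt
  refine ContinuousLinearMap.ext fun f => cf_ext fun i j => ?_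
  rw [mul_apply_eq_comp, cf_Mz_pow, cf_Mw_pow, cf_shiftHJ]; congr 1; ring

theorem koszulExact_of_shift_right (hJ : IsDiagram J) {a n : ℕ}
    (h : ∀ i j, (i, j) ∈ J → (i + (a : ℤ), j + -(n : ℤ)) ∈ J) {μ lam : ℂ}
    (hlt : ‖lam‖ ^ n < ‖μ‖ ^ a) :
    KoszulExact (μ • ContinuousLinearMap.id ℂ (HJ J) - Mw hJ)
      (lam • ContinuousLinearMap.id ℂ (HJ J) - Mz hJ) := by
  refine koszulExact_of_pow_eq_right (commute_Mw_Mz hJ) (commute_Mw_shiftHJ hJ h)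
    (commute_Mz_shiftHJ hJ h) (norm_shiftHJ_le h) ?_ hlt
  refine ContinuousLinearMap.ext fun f => cf_ext fun i j => ?_
  rw [mul_apply_eq_comp, cf_Mw_pow, cf_Mz_pow, cf_shiftHJ]; congr 1; ring

/-- Every diagram is invariant under (1, 0); with n = 0 the norm condition reads 1 < |μ|. -/
theorem koszulExact_of_one_lt_left (hJ : IsDiagram J) {μ lam : ℂ} (h : 1 < ‖μ‖) :
    KoszulExact (μ • ContinuousLinearMap.id ℂ (HJ J) - Mw hJ)
      (lam • ContinuousLinearMap.id ℂ (HJ J) - Mz hJ) :=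
  koszulExact_of_shift_right (a := 1) (n := 0) hJ
    (fun i j hij => by simpa using hJ i j hij 1 0) (by simpa using h)

theorem koszulExact_of_one_lt_right (hJ : IsDiagram J) {μ lam : ℂ} (h : 1 < ‖lam‖) :
    KoszulExact (μ • ContinuousLinearMap.id ℂ (HJ J) - Mw hJ)
      (lam • ContinuousLinearMap.id ℂ (HJ J) - Mz hJ) :=
  koszulExact_of_shift_left (b := 0) (n := 1) hJ
    (fun i j hij => by simpa using hJ i j hij 0 1) (by simpa using h)

end Coefficients

/-! ### Bilateral weighted shifts -/

section WeightedShift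

/-- If the square sums of the products of consecutive weights are bounded uniformly in the starting
point, then all products of some fixed length are less than `1`. -/
theorem exists_forall_prod_lt_one {u : ℤ → ℝ} (hu : ∀ j, 0 ≤ u j) {K : ℝ}
    (h : ∀ k : ℤ, ∀ n : ℕ,
      ∑ m ∈ Finset.range n, (∏ i ∈ Finset.range m, u (k + (i : ℕ))) ^ 2 ≤ K) :
    ∃ n ≥ 1, ∀ k : ℤ, ∏ i ∈ Finset.range n, u (k + (i : ℕ)) < 1 := by
  by_contra! hcon
  set c : ℤ → ℕ → ℝ := fun k m => ∏ i ∈ Finset.range m, u (k + (i : ℕ)) with hc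
  have hc0 (k m) : 0 ≤ c k m := Finset.prod_nonneg fun i _ => hu _
  have hK1 : 1 ≤ K := by simpa using h 0 1
  have hcK (k : ℤ) (m : ℕ) : c k m ^ 2 ≤ K :=
    (Finset.single_le_sum (f := fun m => c k m ^ 2) (fun i _ => sq_nonneg _)
      (Finset.self_mem_range_succ m)).trans (h k (m + 1))
  -- In a window of length n with product at least 1, every initial product has square at least 1/K,
  -- because the complementary product has square at most K. The n squares then sum to at least n/K,
  -- which exceeds K.
  obtain ⟨n, hn⟩ := exists_nat_gt (K ^ 2)
  have hn1 : 1 ≤ n := by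
    by_contra h0
    have : n = 0 := by omega
    subst this
    exact absurd hn (by push_cast; exact not_lt.mpr (sq_nonneg K))
  obtain ⟨k, hk⟩ := hcon n hn1
  have hsum := h k n
  have hlow : ∀ m ∈ Finset.range n, 1 / K ≤ c k m ^ 2 := by
    intro m hm
    have hmn := (Finset.mem_range.mp hm).le
    have e : c k n = c k m * c (k + m) (n - m) := by
      obtain ⟨r, rfl⟩ := Nat.exists_eq_add_of_le hmn
      simp only [hc, Nat.add_sub_cancel_left, Finset.prod_range_add]
      congr 1
      refine Finset.prod_congr rfl fun i _ => ?_
      push_cast; rw [add_assoc]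
    rw [div_le_iff₀ (by linarith)]
    have h1 : 1 ≤ c k n ^ 2 := one_le_pow₀ hk
    rw [e, mul_pow] at h1
    exact h1.trans (mul_le_mul_of_nonneg_left (hcK _ _) (sq_nonneg _))
  have h2 := (Finset.card_nsmul_le_sum _ _ _ hlow).trans hsum
  rw [Finset.card_range, nsmul_eq_mul, mul_one_div, div_le_iff₀ (by linarith)] at h2
  nlinarith

variable {w : ℤ → ℂ} {lam : ℂ}

/-- A square-summable left tail and a square-summable right tail of the homogeneous recurrence
combine into a kernel vector of λ - W, provided that continuing the left tail to N lands on a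
multiple of the right one. -/
theorem exists_null_of_glue {x y : ℤ → ℂ} (hlam : lam ≠ 0) {k N : ℤ} (hkN : k ≤ N)
    (hx : ∀ j < k, lam * x j = w (j - 1) * x (j - 1)) (hxk : x (k - 1) ≠ 0)
    (hy : ∀ j > N, lam * y j = w (j - 1) * y (j - 1))
    (hxs : Summable fun j => ‖x j‖ ^ 2) (hys : Summable fun j => ‖y j‖ ^ 2) {c : ℂ}
    (hc : (∏ i ∈ Finset.range (N - (k - 1)).toNat, w (k - 1 + (i : ℕ)) / lam) * x (k - 1)
      = c * y N) :
    ∃ p : ℤ → ℂ, p ≠ 0 ∧ (Summable fun j => ‖p j‖ ^ 2) ∧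
      ∀ j, lam * p j = w (j - 1) * p (j - 1) := by
  -- The continuation of x (k - 1) to the right by the homogeneous recurrence, which ignores any
  -- source at k.
  set q : ℤ → ℂ := fun j =>
    (∏ i ∈ Finset.range (j - (k - 1)).toNat, w (k - 1 + (i : ℕ)) / lam) * x (k - 1) with hq
  have hqs (j : ℤ) (hj : k ≤ j) : lam * q j = w (j - 1) * q (j - 1) := by
    obtain ⟨t, rfl⟩ := Int.le.dest hj
    have e1 : (k + (t : ℤ) - (k - 1)).toNat = t + 1 := by omega
    have e2 : (k + (t : ℤ) - 1 - (k - 1)).toNat = t := by omega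
    simp only [hq, e1, e2, Finset.prod_range_succ]
    have e3 : k - 1 + (t : ℤ) = k + t - 1 := by ring
    rw [e3]; field_simp
  have hq0 : q (k - 1) = x (k - 1) := by simp [hq]
  have hqy (t : ℕ) : q (N + t) = c * y (N + t) := by
    induction t with
    | zero => simpa [hq] using hc
    | succ t ih =>
      have h1 := hqs (N + (t + 1 : ℕ)) (by push_cast; omega)
      have h2 := hy (N + (t + 1 : ℕ)) (by push_cast; omega)
      have e : N + ((t + 1 : ℕ) : ℤ) - 1 = N + t := by push_cast; ring
      rw [e] at h1 h2
      rw [ih] at h1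
      apply mul_left_cancel₀ hlam
      rw [h1]; linear_combination -c * h2
  set p : ℤ → ℂ := fun j => if j < k then x j else q j with hp
  refine ⟨p, fun h0 => hxk ?_, ?_, fun j => ?_⟩
  · have := congrFun h0 (k - 1)
    simpa [hp] using this
  · refine Summable.of_norm_bounded_eventually (hxs.add (hys.mul_left (‖c‖ ^ 2))) ?_
    have : ((Finset.Icc k N : Finset ℤ) : Set ℤ)ᶜ ∈ (cofinite : Filter ℤ) :=
      (Finset.finite_toSet _).compl_mem_cofinite
    filter_upwards [this] with j hj
    rw [Real.norm_of_nonneg (sq_nonneg _)]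
    simp only [Finset.coe_Icc, mem_compl_iff, mem_Icc, not_and_or, not_le] at hj
    by_cases hjk : j < k
    · simp only [hp, if_pos hjk]
      have : 0 ≤ ‖c‖ ^ 2 * ‖y j‖ ^ 2 := by positivity
      linarith
    · have hj' : N ≤ j := by rcases hj with h | h <;> omega
      obtain ⟨t, rfl⟩ := Int.le.dest hj'
      simp only [hp, if_neg hjk, hqy, norm_mul, mul_pow]
      have : 0 ≤ ‖x (N + t)‖ ^ 2 := by positivity
      linarith
  · rcases lt_trichotomy j k with h | h | h
    · simp only [hp, if_pos h, if_pos (show j - 1 < k by omega)]; exact hx j h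
    · subst h
      simp only [hp, lt_irrefl, if_false, if_pos (show j - 1 < j by omega)]
      rw [← hq0]; exact hqs j le_rfl
    · simp only [hp, if_neg (show ¬ j < k by omega), if_neg (show ¬ j - 1 < k by omega)]
      exact hqs j h.le

/-- `x` solves `(lam - W) x = e_k` for the weighted shift `W e_j = w_j e_{j+1}`. -/
def IsShiftSol (w : ℤ → ℂ) (lam : ℂ) (k : ℤ) (x : ℤ → ℂ) : Prop :=
  ∀ j, lam * x j - w (j - 1) * x (j - 1) = if j = k then 1 else 0

theorem IsShiftSol.eq_of_ne {k : ℤ} {x : ℤ → ℂ} (h : IsShiftSol w lam k x) {j : ℤ} (hj : j ≠ k) :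
    lam * x j = w (j - 1) * x (j - 1) := by
  have := h j
  rwa [if_neg hj, sub_eq_zero] at this

/-- If nothing enters k from the left, the right half of the solution is forced: its entries are
window products of w/λ, up to one factor λ. -/
theorem IsShiftSol.right {k : ℤ} {x : ℤ → ℂ} (h : IsShiftSol w lam k x)
    (h0 : w (k - 1) * x (k - 1) = 0) (m : ℕ) :
    lam ^ (m + 1) * x (k + m) = ∏ i ∈ Finset.range m, w (k + (i : ℕ)) := by
  induction m with
  | zero =>
    have := h k
    rw [h0] at this
    simpa using this
  | succ m ih =>
    have h1 := h.eq_of_ne (j := k + (m + 1 : ℕ)) (by push_cast; omega)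
    have e : k + ((m + 1 : ℕ) : ℤ) - 1 = k + m := by push_cast; ring
    rw [e] at h1
    rw [Finset.prod_range_succ, ← ih, pow_succ lam (m + 1), mul_assoc, h1]; ring

/-- The mirror case: the source at k is balanced from k - 1 alone, and the left half is forced, with
the weights in the denominator. -/
theorem IsShiftSol.left {k : ℤ} {x : ℤ → ℂ} (h : IsShiftSol w lam k x) (h0 : lam * x k = 0)
    (m : ℕ) :
    x (k - 1 - m) * ∏ i ∈ Finset.range (m + 1), w (k - 1 - (i : ℕ)) = -lam ^ m := by
  induction m with
  | zero =>
    have := h k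
    rw [h0] at this
    simp at this ⊢
    linear_combination -this
  | succ m ih =>
    have h1 := h.eq_of_ne (j := k - 1 - m) (by omega)
    have e : k - 1 - (m : ℤ) - 1 = k - 1 - (m + 1 : ℕ) := by push_cast; ring
    rw [e] at h1
    rw [Finset.prod_range_succ]
    linear_combination (-∏ i ∈ Finset.range (m + 1), w (k - 1 - (i : ℕ))) * h1 + lam * ih

/-- The ℓ² bound on the forward solutions is a bound on the square sums of window products of
|w|/|λ|, as `exists_forall_prod_lt_one` requires. -/
theorem exists_forall_prod_lt_pow {F : Set ℤ} (hw : ∀ j, w j ≠ 0 → j ∈ F ∧ j + 1 ∈ F)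
    (hlam : lam ≠ 0) {K : ℝ}
    (h : ∀ k ∈ F, ∃ x, IsShiftSol w lam k x ∧ w (k - 1) * x (k - 1) = 0 ∧
      (Summable fun j => ‖x j‖ ^ 2) ∧ ∑' j, ‖x j‖ ^ 2 ≤ K) :
    ∃ n ≥ 1, ∀ k : ℤ, ∏ i ∈ Finset.range n, ‖w (k + (i : ℕ))‖ < ‖lam‖ ^ n := by
  have hl : 0 < ‖lam‖ := norm_pos_iff.mpr hlam
  have hsq (k : ℤ) (n : ℕ) : ∑ m ∈ Finset.range n,
      (∏ i ∈ Finset.range m, ‖w (k + (i : ℕ))‖ / ‖lam‖) ^ 2 ≤ max 1 (‖lam‖ ^ 2 * K) := by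
    by_cases hk : k ∈ F
    · obtain ⟨x, hx, h0, hs, hK⟩ := h k hk
      refine le_trans ?_ (le_max_right _ _)
      have e (m : ℕ) : (∏ i ∈ Finset.range m, ‖w (k + (i : ℕ))‖ / ‖lam‖) ^ 2
          = ‖lam‖ ^ 2 * ‖x (k + m)‖ ^ 2 := by
        rw [Finset.prod_div_distrib, Finset.prod_const, Finset.card_range, ← norm_prod,
          ← hx.right h0 m, norm_mul, norm_pow]
        field_simp
        ring
      simp only [e, ← Finset.mul_sum]
      gcongr
      refine le_trans ?_ hK
      have := hs.sum_le_tsum ((Finset.range n).map ⟨fun m : ℕ => k + (m : ℤ), fun a b h => by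
        simpa using h⟩) (fun _ _ => sq_nonneg _)
      rwa [Finset.sum_map] at this
    -- A window that starts off F has first weight zero, so only the empty product contributes;
    -- hence the 1 in the maximum.
    · have hwk : w k = 0 := by
        by_contra hne; exact hk (hw k hne).1
      refine le_trans ?_ (le_max_left _ _)
      rcases n with _ | n
      · simp
      · rw [Finset.sum_range_succ', Finset.sum_eq_zero]
        · simp
        · intro m _
          rw [Finset.prod_range_succ']; simp [hwk]
  obtain ⟨n, hn, hlt⟩ := exists_forall_prod_lt_one (u := fun j => ‖w j‖ / ‖lam‖)
    (fun j => by positivity) hsq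
  refine ⟨n, hn, fun k => ?_⟩
  have := hlt k
  rw [Finset.prod_div_distrib, Finset.prod_const, Finset.card_range, div_lt_one (by positivity)]
    at this
  exact this

theorem exists_forall_pow_lt_prod (hw : ∀ j, w j ≠ 0) {K : ℝ}
    (h : ∀ k, ∃ x, IsShiftSol w lam k x ∧ lam * x k = 0 ∧
      (Summable fun j => ‖x j‖ ^ 2) ∧ ∑' j, ‖x j‖ ^ 2 ≤ K) :
    (∃ ε > 0, ∀ k, ε ≤ ‖w k‖) ∧
    ∃ n ≥ 1, ∀ k : ℤ, ‖lam‖ ^ n < ∏ i ∈ Finset.range n, ‖w (k + (i : ℕ))‖ := by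
  have hwpos (j) : 0 < ‖w j‖ := norm_pos_iff.mpr (hw j)
  constructor
  -- The solution with source at k + 1 has the entry -1 / w k at k.
  · have hb (k : ℤ) : 1 ≤ K * ‖w k‖ ^ 2 := by
      obtain ⟨x, hx, h0, hs, hK⟩ := h (k + 1)
      have h1 := hx.left h0 0
      have h2 : ‖x k‖ ^ 2 ≤ K := (hs.le_tsum k fun _ _ => sq_nonneg _).trans hK
      simp at h1
      have h3 := congrArg (fun z => ‖z‖ ^ 2) h1
      simp [mul_pow] at h3
      rw [← h3]; gcongr
    have hK : 0 < K := by
      by_contra! hK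
      have := hb 0
      nlinarith [sq_nonneg ‖w 0‖]
    refine ⟨1 / √K, by positivity, fun k => ?_⟩
    rw [div_le_iff₀ (by positivity)]
    have := Real.le_sqrt_of_sq_le (x := 1) (by simpa using hb k)
    rwa [Real.sqrt_mul hK.le, Real.sqrt_sq (norm_nonneg _), mul_comm] at this
  -- The index is reflected so that backward solutions produce forward windows; source -k + 1 makes
  -- the first weight w (-k).
  · have hsq (k : ℤ) (n : ℕ) : ∑ m ∈ Finset.range n,
        (∏ i ∈ Finset.range m, ‖lam‖ / ‖w (-(k + (i : ℕ)))‖) ^ 2 ≤ 1 + ‖lam‖ ^ 2 * K := by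
      obtain ⟨x, hx, h0, hs, hK⟩ := h (-k + 1)
      have hKs : ∑ m ∈ Finset.range n, ‖lam‖ ^ 2 * ‖x (-k - m)‖ ^ 2 ≤ ‖lam‖ ^ 2 * K := by
        rw [← Finset.mul_sum]
        gcongr
        refine le_trans ?_ hK
        have := hs.sum_le_tsum ((Finset.range n).map ⟨fun m : ℕ => -k - (m : ℤ), fun a b h => by
          simpa using h⟩) (fun _ _ => sq_nonneg _)
        rwa [Finset.sum_map] at this
      have e (m : ℕ) : (∏ i ∈ Finset.range (m + 1), ‖lam‖ / ‖w (-(k + (i : ℕ)))‖) ^ 2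
          = ‖lam‖ ^ 2 * ‖x (-k - m)‖ ^ 2 := by
        have h1 := congrArg norm (hx.left h0 m)
        simp only [add_sub_cancel_right, norm_mul, norm_prod, norm_neg, norm_pow] at h1
        have e2 : ∏ i ∈ Finset.range (m + 1), ‖w (-(k + (i : ℕ)))‖
          = ∏ i ∈ Finset.range (m + 1), ‖w (-k - (i : ℕ))‖ :=
            Finset.prod_congr rfl fun i _ => by congr 2; ring
        have hpos : 0 < ∏ i ∈ Finset.range (m + 1), ‖w (-k - (i : ℕ))‖ :=
          Finset.prod_pos fun _ _ => hwpos _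
        rw [Finset.prod_div_distrib, Finset.prod_const, Finset.card_range, e2, pow_succ ‖lam‖ m, ← h1]
        field_simp
      have hnn : ∀ m, 0 ≤ ‖lam‖ ^ 2 * ‖x (-k - m)‖ ^ 2 := fun m => by positivity
      rcases n with _ | n
      · simp at hKs ⊢
        linarith
      · rw [Finset.sum_range_succ']
        simp only [e]
        rw [Finset.sum_range_succ] at hKs
        have := hnn n
        simp
        linarith
    obtain ⟨n, hn, hlt⟩ := exists_forall_prod_lt_one (u := fun j => ‖lam‖ / ‖w (-j)‖)
      (fun j => by positivity) hsq
    refine ⟨n, hn, fun k => ?_⟩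
    have := hlt (-(k + n - 1))
    rw [Finset.prod_div_distrib, Finset.prod_const, Finset.card_range,
      div_lt_one (Finset.prod_pos fun _ _ => hwpos _)] at this
    refine this.trans_eq ?_
    rw [← Finset.prod_range_reflect]
    refine Finset.prod_congr rfl fun i hi => ?_
    rw [Finset.mem_range] at hi
    congr 2; omega


/-- If `lam - W` is invertible for a weighted shift `W` on `ℓ²(F)`, then `|lam|` lies strictly above
or strictly below all the geometric means of the weights over windows of some fixed length. -/
theorem weightedShift_dichotomy {F : Set ℤ} (hF : F.Nonempty)
    (hw : ∀ j, w j ≠ 0 → j ∈ F ∧ j + 1 ∈ F) {K : ℝ}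
    (hsol : ∀ k ∈ F, ∃ x, IsShiftSol w lam k x ∧
      (Summable fun j => ‖x j‖ ^ 2) ∧ ∑' j, ‖x j‖ ^ 2 ≤ K)
    (hinj : ∀ p : ℤ → ℂ, (Summable fun j => ‖p j‖ ^ 2) → (∀ j ∉ F, p j = 0) →
      (∀ j, lam * p j = w (j - 1) * p (j - 1)) → p = 0) :
    (lam ≠ 0 ∧ ∃ n ≥ 1, ∀ k : ℤ, ∏ i ∈ Finset.range n, ‖w (k + (i : ℕ))‖ < ‖lam‖ ^ n) ∨
    ((∀ j, w j ≠ 0) ∧ (∃ ε > 0, ∀ k, ε ≤ ‖w k‖) ∧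
      ∃ n ≥ 1, ∀ k : ℤ, ‖lam‖ ^ n < ∏ i ∈ Finset.range n, ‖w (k + (i : ℕ))‖) := by
  by_cases hlam : lam = 0
  · subst hlam
    -- For λ = 0, solvability at k needs w (k - 1) ≠ 0 and injectivity needs w k ≠ 0. So F is closed
    -- under both neighbours and is all of ℤ.
    have hpred (k) (hk : k ∈ F) : k - 1 ∈ F := by
      obtain ⟨x, hx, -, -⟩ := hsol k hk
      have h1 := hx k
      refine (hw _ fun h0 => ?_).1
      simp [h0] at h1
    have hwk (k) (hk : k ∈ F) : w k ≠ 0 := by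
      intro h0
      have := hinj (Pi.single k 1) ?_ ?_ ?_
      · simpa using congrFun this k
      · refine summable_of_ne_finset_zero (s := {k}) fun j hj => ?_
        rw [Pi.single_eq_of_ne (by simpa using hj)]; simp
      · intro j hj
        rw [Pi.single_eq_of_ne]; rintro rfl; exact hj hk
      · intro j
        by_cases hj : j - 1 = k
        · rw [hj, h0]; simp
        · rw [Pi.single_eq_of_ne hj]; simp
    have hsucc (k) (hk : k ∈ F) : k + 1 ∈ F := (hw k (hwk k hk)).2
    obtain ⟨k₀, hk₀⟩ := hF
    have hall (k) : k ∈ F := by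
      induction k using Int.inductionOn' (b := k₀) with
      | zero => exact hk₀
      | succ k _ h => exact hsucc k h
      | pred k _ h => exact hpred k h
    right
    refine ⟨fun j => hwk j (hall j), exists_forall_pow_lt_prod (fun j => hwk j (hall j)) (K := K)
      fun k => ?_⟩
    obtain ⟨x, h1, h2, h3⟩ := hsol k (hall k)
    exact ⟨x, h1, zero_mul _, h2, h3⟩
  -- For λ ≠ 0 a solution of the homogeneous recurrence is automatically supported in F.
  have hnull : ¬ ∃ p : ℤ → ℂ, p ≠ 0 ∧ (Summable fun j => ‖p j‖ ^ 2) ∧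
      ∀ j, lam * p j = w (j - 1) * p (j - 1) := by
    rintro ⟨p, hp, hs, hr⟩
    refine hp (hinj p hs (fun j hj => ?_) hr)
    by_contra hne
    have h1 : w (j - 1) ≠ 0 := by
      intro h0
      have := hr j
      rw [h0, zero_mul] at this
      exact mul_ne_zero hlam hne this
    have := (hw _ h1).2
    rw [sub_add_cancel] at this
    exact hj this
  by_cases hz : ∃ j₀, w j₀ = 0
  · obtain ⟨j₀, hj₀⟩ := hz
    left
    refine ⟨hlam, exists_forall_prod_lt_pow hw hlam (K := K) fun k hk => ?_⟩
    obtain ⟨x, hx, hs, hK⟩ := hsol k hk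
    refine ⟨x, hx, ?_, hs, hK⟩
    by_contra hne
    have hw1 : w (k - 1) ≠ 0 := left_ne_zero_of_mul hne
    have hx1 : x (k - 1) ≠ 0 := right_ne_zero_of_mul hne
    -- A zero weight to the left of k - 1 kills everything between it and k, including x (k - 1).
    -- One to the right stops the continued left tail of x, which becomes a kernel vector.
    rcases lt_trichotomy j₀ (k - 1) with hlt | heq | hgt
    · have hzero (t : ℕ) (ht : j₀ + 1 + t < k) : x (j₀ + 1 + t) = 0 := by
        induction t with
        | zero =>
          have := hx.eq_of_ne (j := j₀ + 1) (by simp at ht; omega)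
          simp [hj₀, hlam] at this
          simpa using this
        | succ t ih =>
          have h1 := hx.eq_of_ne (j := j₀ + 1 + (t + 1 : ℕ)) (by omega)
          have e : j₀ + 1 + ((t + 1 : ℕ) : ℤ) - 1 = j₀ + 1 + t := by push_cast; ring
          rw [e, ih (by push_cast at ht; omega), mul_zero] at h1
          exact (mul_eq_zero.mp h1).resolve_left hlam
      obtain ⟨t, ht⟩ := Int.le.dest (show j₀ + 1 ≤ k - 1 by omega)
      exact hx1 (ht ▸ hzero t (by omega))
    · exact hw1 (heq ▸ hj₀)
    · refine hnull (exists_null_of_glue (x := x) (y := 0) (k := k) (N := j₀ + 1) (c := 0) hlam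
        (by omega) (fun j hj => hx.eq_of_ne hj.ne) hx1 (by simp) hs (by simp) ?_)
      rw [Finset.prod_eq_zero (i := (j₀ - (k - 1)).toNat) (Finset.mem_range.mpr (by omega))]
      · simp
      · have : k - 1 + ((j₀ - (k - 1)).toNat : ℤ) = j₀ := by omega
        rw [this, hj₀, zero_div]
  · push Not at hz
    have hall (k) : k ∈ F := (hw k (hz k)).1
    -- If some solution has a nonzero left tail, then no solution can have a nonzero right tail,
    -- since the two would glue to a kernel vector. So either all solutions are forward or all are
    -- backward.
    by_cases hr : ∀ k x, IsShiftSol w lam k x → (Summable fun j => ‖x j‖ ^ 2) → x (k - 1) = 0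
    · left
      refine ⟨hlam, exists_forall_prod_lt_pow hw hlam (K := K) fun k hk => ?_⟩
      obtain ⟨x, hx, hs, hK⟩ := hsol k hk
      exact ⟨x, hx, by rw [hr k x hx hs, mul_zero], hs, hK⟩
    · push Not at hr
      obtain ⟨k, x, hx, hxs, hx1⟩ := hr
      right
      refine ⟨hz, exists_forall_pow_lt_prod hz (K := K) fun l => ?_⟩
      obtain ⟨y, hy, hys, hyK⟩ := hsol l (hall l)
      refine ⟨y, hy, ?_, hys, hyK⟩
      by_contra hyl
      have hyne (t : ℕ) : y (l + t) ≠ 0 := by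
        induction t with
        | zero => simpa using right_ne_zero_of_mul hyl
        | succ t ih =>
          intro h0
          have h1 := hy.eq_of_ne (j := l + (t + 1 : ℕ)) (by push_cast; omega)
          have e : l + ((t + 1 : ℕ) : ℤ) - 1 = l + t := by push_cast; ring
          rw [e, h0, mul_zero] at h1
          exact mul_ne_zero (hz _) ih h1.symm
      obtain ⟨t, ht⟩ := Int.le.dest (le_max_right k l)
      refine hnull (exists_null_of_glue (x := x) (y := y) (k := k) (N := max k l) hlam
        (le_max_left _ _) (fun j hj => hx.eq_of_ne hj.ne) hx1
        (fun j hj => hy.eq_of_ne (by omega)) hxs hys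
        (c := (∏ i ∈ Finset.range (max k l - (k - 1)).toNat, w (k - 1 + (i : ℕ)) / lam)
          * x (k - 1) / y (max k l)) ?_)
      rw [div_mul_cancel₀]
      rw [← ht]; exact hyne t

end WeightedShift

/-! ### Evaluation of the rows at a point of the disc -/

section RowEvaluation

variable {J : Set (ℤ × ℤ)} {μ lam : ℂ}

theorem summable_mul_geometric {a : ℕ → ℂ} (ha : Summable fun t => ‖a t‖ ^ 2) (hμ : ‖μ‖ < 1) :
    Summable fun t => a t * μ ^ t := by
  have hg : Summable fun t : ℕ => (‖μ‖ ^ 2) ^ t :=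
    summable_geometric_of_lt_one (sq_nonneg _) (pow_lt_one₀ (norm_nonneg _) hμ two_ne_zero)
  refine Summable.of_norm_bounded (ha.add hg) fun t => ?_
  rw [norm_mul, norm_pow, ← pow_mul, mul_comm 2 t, pow_mul]
  nlinarith [sq_nonneg (‖a t‖ - ‖μ‖ ^ t), sq_nonneg (‖a t‖), sq_nonneg (‖μ‖ ^ t)]

theorem norm_tsum_mul_geometric_sq_le {a : ℕ → ℂ} (ha : Summable fun t => ‖a t‖ ^ 2)
    (hμ : ‖μ‖ < 1) :
    ‖∑' t, a t * μ ^ t‖ ^ 2 ≤ (1 - ‖μ‖ ^ 2)⁻¹ * ∑' t, ‖a t‖ ^ 2 := by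
  have hlt : ‖μ‖ ^ 2 < 1 := pow_lt_one₀ (norm_nonneg _) hμ two_ne_zero
  have hg := hasSum_geometric_of_lt_one (sq_nonneg ‖μ‖) hlt
  have hs := (summable_mul_geometric ha hμ).norm
  have hB : 0 ≤ (1 - ‖μ‖ ^ 2)⁻¹ * ∑' t, ‖a t‖ ^ 2 :=
    mul_nonneg (inv_nonneg.mpr (by linarith)) (tsum_nonneg fun _ => sq_nonneg _)
  have h : ∑' t, ‖a t * μ ^ t‖ ≤ √((1 - ‖μ‖ ^ 2)⁻¹ * ∑' t, ‖a t‖ ^ 2) := by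
    refine hs.tsum_le_of_sum_le fun s => Real.le_sqrt_of_sq_le ?_
    simp only [norm_mul, norm_pow]
    refine (Finset.sum_mul_sq_le_sq_mul_sq s _ _).trans ?_
    rw [mul_comm]
    refine mul_le_mul ?_ (ha.sum_le_tsum s fun _ _ => sq_nonneg _)
      (Finset.sum_nonneg fun _ _ => sq_nonneg _) (inv_nonneg.mpr (by linarith))
    rw [← hg.tsum_eq]
    simp only [← pow_mul, mul_comm _ 2]
    simp only [pow_mul]
    exact hg.summable.sum_le_tsum s fun _ _ => by positivity
  exact (Real.le_sqrt (norm_nonneg _) hB).mp ((norm_tsum_le_tsum_norm hs).trans h)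

/-- The sum `∑ t, f_{n + t, j} μ ^ t`. -/
def rowEval (μ : ℂ) (n j : ℤ) (f : HJ J) : ℂ := ∑' t : ℕ, cf f (n + t) j * μ ^ t

theorem summable_cf_row (f : HJ J) (n j : ℤ) :
    Summable fun t : ℕ => ‖cf f (n + t) j‖ ^ 2 :=
  (summable_norm_cf_sq f).comp_injective (i := fun t : ℕ => ((n + t : ℤ), j)) fun a b h => by
    simpa using h

theorem hasSum_rowEval (hμ : ‖μ‖ < 1) (n j : ℤ) (f : HJ J) :
    HasSum (fun t : ℕ => cf f (n + t) j * μ ^ t) (rowEval μ n j f) :=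
  (summable_mul_geometric (summable_cf_row f n j) hμ).hasSum

theorem rowEval_sub (hμ : ‖μ‖ < 1) (n j : ℤ) (f g : HJ J) :
    rowEval μ n j (f - g) = rowEval μ n j f - rowEval μ n j g := by
  refine HasSum.unique (hasSum_rowEval hμ n j (f - g)) ?_
  refine HasSum.congr_fun ((hasSum_rowEval hμ n j f).sub (hasSum_rowEval hμ n j g)) fun t => ?_
  rw [cf_sub, sub_mul]

theorem rowEval_smul (c : ℂ) (n j : ℤ) (f : HJ J) :
    rowEval μ n j (c • f) = c * rowEval μ n j f := by
  simp only [rowEval, cf_smul, mul_assoc, tsum_mul_left]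

/-- Evaluation at μ is bounded on each row by Cauchy–Schwarz; summed over j, it becomes a bounded
map into ℓ² for any choice of starting points. -/
theorem summable_rowEval_sq (hμ : ‖μ‖ < 1) (m : ℤ → ℤ) (f : HJ J) :
    (Summable fun j => ‖rowEval μ (m j) j f‖ ^ 2) ∧
      ∑' j, ‖rowEval μ (m j) j f‖ ^ 2 ≤ (1 - ‖μ‖ ^ 2)⁻¹ * ‖f‖ ^ 2 := by
  have hlt : ‖μ‖ ^ 2 < 1 := pow_lt_one₀ (norm_nonneg _) hμ two_ne_zero
  have hnn : 0 ≤ (1 - ‖μ‖ ^ 2)⁻¹ := inv_nonneg.mpr (by linarith)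
  have h1 := hasSum_norm_cf_sq f
  rw [← (Equiv.prodComm ℤ ℤ).hasSum_iff] at h1
  have h2 : HasSum (fun j : ℤ => ∑' i : ℤ, ‖cf f i j‖ ^ 2) (‖f‖ ^ 2) :=
    h1.prod_fiberwise fun j => (h1.summable.prod_factor j).hasSum
  have hle (j : ℤ) : ‖rowEval μ (m j) j f‖ ^ 2 ≤ (1 - ‖μ‖ ^ 2)⁻¹ * ∑' i : ℤ, ‖cf f i j‖ ^ 2 := by
    refine (norm_tsum_mul_geometric_sq_le (summable_cf_row f (m j) j) hμ).trans ?_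
    gcongr
    exact (summable_cf_row f (m j) j).tsum_le_tsum_of_inj (fun t : ℕ => m j + (t : ℤ))
      (fun a b h => by simpa using h) (fun _ _ => sq_nonneg _) (fun _ => le_rfl)
      (h1.summable.prod_factor j)
  have h3 := h2.mul_left (1 - ‖μ‖ ^ 2)⁻¹
  have hs := Summable.of_nonneg_of_le (fun _ => sq_nonneg _) hle h3.summable
  exact ⟨hs, (hs.tsum_le_tsum hle h3.summable).trans_eq h3.tsum_eq⟩

/-- No coefficient enters at position n from outside, so evaluation is an eigenfunctional of M_w and
annihilates the range of μ - M_w. -/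
theorem rowEval_Mw (hJ : IsDiagram J) (hμ : ‖μ‖ < 1) {n j : ℤ} (h : (n - 1, j) ∉ J) (f : HJ J) :
    rowEval μ n j (Mw hJ f) = μ * rowEval μ n j f := by
  refine HasSum.unique (hasSum_rowEval hμ n j _) ?_
  have h0 : cf f (n - 1) j = 0 := cf_eq_zero f h
  rw [← hasSum_nat_add_iff' 1, Finset.sum_range_one, cf_Mw, Nat.cast_zero, add_zero, h0, zero_mul,
    sub_zero]
  refine HasSum.congr_fun ((hasSum_rowEval hμ n j f).mul_left μ) fun t => ?_
  rw [cf_Mw, pow_succ]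
  push_cast
  rw [← add_assoc, add_sub_cancel_right]; ring

theorem rowEval_Mz_of_forall_notMem (hJ : IsDiagram J) {n j : ℤ} (h : ∀ i, (i, j - 1) ∉ J)
    (f : HJ J) : rowEval μ n j (Mz hJ f) = 0 := by
  simp [rowEval, cf_eq_zero f (h _)]

/-- Row j may start earlier than row j - 1; measuring exponents from the earlier start costs the
factor μ^(n' - n). -/
theorem rowEval_Mz (hJ : IsDiagram J) (hμ : ‖μ‖ < 1) {n n' j : ℤ} (hn : n ≤ n')
    (h : ∀ i < n', (i, j - 1) ∉ J) (f : HJ J) :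
    rowEval μ n j (Mz hJ f) = μ ^ (n' - n).toNat * rowEval μ n' (j - 1) f := by
  obtain ⟨d, rfl⟩ := Int.le.dest hn
  rw [add_sub_cancel_left, Int.toNat_natCast]
  refine HasSum.unique (hasSum_rowEval hμ n j _) ?_
  rw [← hasSum_nat_add_iff' d, Finset.sum_eq_zero, sub_zero]
  · refine HasSum.congr_fun ((hasSum_rowEval hμ (n + d) (j - 1) f).mul_left (μ ^ d)) fun t => ?_
    rw [cf_Mz, pow_add]
    push_cast
    rw [add_assoc n, add_comm (d : ℤ)]; ring
  · intro t ht
    rw [Finset.mem_range] at ht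
    rw [cf_Mz, cf_eq_zero f (h _ (by omega)), zero_mul]

/-! ### The weighted shift induced by M_z on the half-line rows -/

/-- `F` is the set of rows of `J` that are half-lines, and `m` lists their end points. -/
structure IsBorder (J : Set (ℤ × ℤ)) (F : Set ℤ) (m : ℤ → ℤ) : Prop where
  mem_iff : ∀ j ∈ F, ∀ i, (i, j) ∈ J ↔ m j ≤ i
  full_or_empty : ∀ j ∉ F, (∀ i, (i, j) ∈ J) ∨ ∀ i, (i, j) ∉ J

open Classical in
/-- The weights of the shift that multiplication by `z` induces on `H_J / (μ - w) H_J`. -/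
def shiftWeight (μ : ℂ) (F : Set ℤ) (m : ℤ → ℤ) (j : ℤ) : ℂ :=
  if j ∈ F ∧ j + 1 ∈ F then μ ^ (m j - m (j + 1)).toNat else 0

theorem shiftWeight_ne_zero {F : Set ℤ} {m : ℤ → ℤ} {j : ℤ} (h : shiftWeight μ F m j ≠ 0) :
    j ∈ F ∧ j + 1 ∈ F := by
  by_contra hn
  exact h (if_neg hn)

variable {F : Set ℤ} {m : ℤ → ℤ}

theorem IsBorder.antitone (hb : IsBorder J F m) (hJ : IsDiagram J) {j : ℤ} (h : j ∈ F) {n : ℕ}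
    (h' : j + n ∈ F) : m (j + n) ≤ m j := by
  have := hJ (m j) j ((hb.mem_iff j h _).mpr le_rfl) 0 n
  simpa using (hb.mem_iff _ h' _).mp this

theorem rowEval_Mz_eq_shiftWeight (hb : IsBorder J F m) (hJ : IsDiagram J) (hμ : ‖μ‖ < 1) {j : ℤ}
    (hj : j ∈ F) (f : HJ J) :
    rowEval μ (m j) j (Mz hJ f) =
      shiftWeight μ F m (j - 1) * rowEval μ (m (j - 1)) (j - 1) f := by
  by_cases hj' : j - 1 ∈ F
  · rw [shiftWeight, sub_add_cancel, if_pos ⟨hj', hj⟩]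
    refine rowEval_Mz hJ hμ ?_ (fun i hi => ?_) f
    · have := hb.antitone hJ hj' (n := 1) (by simpa using hj)
      simpa using this
    · rw [hb.mem_iff _ hj']; omega
  · rw [shiftWeight, if_neg (by tauto), zero_mul]
    refine rowEval_Mz_of_forall_notMem hJ ?_ f
    -- A full row j - 1 would make row j full, so row j - 1 is empty.
    refine (hb.full_or_empty _ hj').resolve_left fun hfull => ?_
    have := hJ (m j - 1) (j - 1) (hfull _) 0 1
    simp only [Nat.cast_zero, add_zero, Nat.cast_one, sub_add_cancel] at this
    have := (hb.mem_iff j hj _).mp this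
    omega

theorem exists_monomial {i j : ℤ} (h : (i, j) ∈ J) :
    ∃ e : HJ J, (∀ i' j', cf e i' j' = if i' = i ∧ j' = j then 1 else 0) ∧ ‖e‖ = 1 := by
  have hfun : (fun x : ℤ × ℤ => ‖(if x.1 = i ∧ x.2 = j then 1 else 0 : ℂ)‖ ^ 2)
      = fun x => if x = (i, j) then (1 : ℝ) else 0 := by
    funext x
    simp only [Prod.ext_iff]
    split_ifs <;> simp
  have hs := hasSum_ite_eq (i, j) (1 : ℝ)
  rw [← hfun] at hs
  obtain ⟨e, he⟩ := exists_cf_eq (J := J) (c := fun i' j' => if i' = i ∧ j' = j then 1 else 0)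
    hs.summable fun i' j' hij => if_neg fun (h' : i' = i ∧ j' = j) => hij (h'.1 ▸ h'.2 ▸ h)
  refine ⟨e, he, ?_⟩
  have h1 := hasSum_norm_cf_sq e
  simp only [he] at h1
  have h2 := h1.unique hs
  exact (pow_eq_one_iff_of_nonneg (norm_nonneg e) two_ne_zero).mp h2

theorem rowEval_monomial {i j : ℤ} {e : HJ J}
    (he : ∀ i' j', cf e i' j' = if i' = i ∧ j' = j then 1 else 0) {j' n : ℤ}
    (hn : j' = j → n = i) : rowEval μ n j' e = if j' = j then 1 else 0 := by
  by_cases hj : j' = j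
  · rw [hn hj, rowEval, tsum_eq_single 0]
    · simp [he, hj]
    · intro t ht
      rw [he, if_neg, zero_mul]
      rintro ⟨h, -⟩
      omega
  · simp [rowEval, he, hj]

/-- The pair of operators whose Koszul complex decides membership of `(μ, lam)` in the spectrum. -/
def KoszulExactAt (hJ : IsDiagram J) (μ lam : ℂ) : Prop :=
  KoszulExact (μ • ContinuousLinearMap.id ℂ (HJ J) - Mw hJ)
    (lam • ContinuousLinearMap.id ℂ (HJ J) - Mz hJ)

/-- Write the corner monomial of row k as (μ - M_w) g - (λ - M_z) f with norm control and evaluate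
the rows. The g-term vanishes, and -f evaluates to a solution with source at k. -/
theorem KoszulExactAt.exists_shiftSol {hJ : IsDiagram J} (hex : KoszulExactAt hJ μ lam)
    (hb : IsBorder J F m) (hμ : ‖μ‖ < 1) :
    ∃ K : ℝ, ∀ k ∈ F, ∃ x, IsShiftSol (shiftWeight μ F m) lam k x ∧
      (Summable fun j => ‖x j‖ ^ 2) ∧ ∑' j, ‖x j‖ ^ 2 ≤ K := by
  classical
  obtain ⟨C, hC, hs⟩ := KoszulExact.exists_preimage hex
  have hlt : ‖μ‖ ^ 2 < 1 := pow_lt_one₀ (norm_nonneg _) hμ two_ne_zero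
  have hnn : 0 ≤ (1 - ‖μ‖ ^ 2)⁻¹ := inv_nonneg.mpr (by linarith)
  refine ⟨(1 - ‖μ‖ ^ 2)⁻¹ * C ^ 2, fun k hk => ?_⟩
  obtain ⟨e, he, hen⟩ := exists_monomial ((hb.mem_iff k hk (m k)).mpr le_rfl)
  obtain ⟨f, g, hfg, hf, -⟩ := hs e
  rw [hen, mul_one] at hf
  obtain ⟨hsum, hle⟩ := summable_rowEval_sq hμ m f
  have hxle (j : ℤ) : ‖(if j ∈ F then -rowEval μ (m j) j f else 0 : ℂ)‖ ^ 2
      ≤ ‖rowEval μ (m j) j f‖ ^ 2 := by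
    split_ifs <;> simp
  have hxs := Summable.of_nonneg_of_le (fun _ => sq_nonneg _) hxle hsum
  refine ⟨fun j => if j ∈ F then -rowEval μ (m j) j f else 0, fun j => ?_, hxs,
    (hxs.tsum_le_tsum hxle hsum).trans (hle.trans (by gcongr))⟩
  by_cases hj : j ∈ F
  · have h1 := congrArg (rowEval μ (m j) j) hfg
    have hn : (m j - 1, j) ∉ J := by rw [hb.mem_iff j hj]; omega
    rw [rowEval_monomial he (by rintro rfl; rfl)] at h1
    simp only [sub_apply, smul_apply,
      ContinuousLinearMap.id_apply, rowEval_sub hμ, rowEval_smul, rowEval_Mw hJ hμ hn,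
      rowEval_Mz_eq_shiftWeight hb hJ hμ hj] at h1
    rw [← h1]
    by_cases hj' : j - 1 ∈ F
    · simp only [if_pos hj, if_pos hj']; ring
    · have h0 : shiftWeight μ F m (j - 1) = 0 := by
        by_contra hne; exact hj' (shiftWeight_ne_zero hne).1
      simp only [if_pos hj, h0]; ring
  · have h0 : shiftWeight μ F m (j - 1) = 0 := by
      by_contra hne
      have := (shiftWeight_ne_zero hne).2
      rw [sub_add_cancel] at this
      exact hj this
    have : j ≠ k := by rintro rfl; exact hj hk
    simp [hj, h0, this]

/-- Lift p to f = ∑ p_j w^(m j) z^j. The null relation gives (λ - M_z) f = (μ - M_w) g for an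
explicit g; exactness in the middle puts f in the range of μ - M_w, so the row evaluations p_j of f
vanish. -/
theorem KoszulExactAt.eq_zero_of_null {hJ : IsDiagram J} (hex : KoszulExactAt hJ μ lam)
    (hb : IsBorder J F m) (hμ : ‖μ‖ < 1) {p : ℤ → ℂ} (hp : Summable fun j => ‖p j‖ ^ 2)
    (hpF : ∀ j ∉ F, p j = 0)
    (hnull : ∀ j, lam * p j = shiftWeight μ F m (j - 1) * p (j - 1)) : p = 0 := by
  classical
  have hlt : ‖μ‖ ^ 2 < 1 := pow_lt_one₀ (norm_nonneg _) hμ two_ne_zero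
  obtain ⟨f, hf⟩ := exists_cf_eq (J := J) (c := fun i j => if i = m j then p j else 0) (by
    have hinj : Function.Injective fun j : ℤ => (m j, j) := fun a b h => (Prod.ext_iff.mp h).2
    rw [← hinj.summable_iff]
    · simpa [Function.comp_def] using hp
    · rintro ⟨i, j⟩ hx
      have : i ≠ m j := by rintro rfl; exact hx ⟨j, rfl⟩
      simp [this]) (by
    intro i j hij
    by_cases hj : j ∈ F
    · exact if_neg fun h => hij ((hb.mem_iff j hj i).mpr h.ge)
    · simp [hpF j hj])
  -- For half-line rows j - 1 and j with d = m (j - 1) - m j, row j of (λ - M_z) f is p_{j-1} w^(m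
  -- j) (μ^d - w^d), and g is its quotient by μ - w. If row j is full, g is an infinite geometric
  -- series to the left, convergent since |μ| < 1.
  obtain ⟨g, hg⟩ := exists_cf_eq (J := J) (c := fun i j => if (i, j) ∈ J ∧ i < m (j - 1) then
      p (j - 1) * μ ^ (m (j - 1) - 1 - i).toNat else 0) (by
    have hs : Summable fun x : ℤ × ℤ => if x.1 < m (x.2 - 1) then
        ‖p (x.2 - 1)‖ ^ 2 * (‖μ‖ ^ 2) ^ (m (x.2 - 1) - 1 - x.1).toNat else 0 := by
      have hinj : Function.Injective fun y : ℤ × ℕ => (m (y.1 - 1) - 1 - (y.2 : ℤ), y.1) := by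
        rintro ⟨a, s⟩ ⟨b, t⟩ h
        simp only [Prod.mk.injEq] at h ⊢
        obtain ⟨h1, rfl⟩ := h
        exact ⟨rfl, by omega⟩
      rw [← hinj.summable_iff]
      · have hp' : Summable fun j => ‖p (j - 1)‖ ^ 2 :=
          hp.comp_injective (i := fun j : ℤ => j - 1) fun a b h => by simpa using h
        refine (hp'.mul_of_nonneg (summable_geometric_of_lt_one (sq_nonneg ‖μ‖) hlt)
          (fun _ => sq_nonneg _) (fun _ => by positivity)).congr fun y => ?_
        have e : (m (y.1 - 1) - 1 - (m (y.1 - 1) - 1 - (y.2 : ℤ))).toNat = y.2 := by omega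
        simp only [Function.comp_def, e]
        rw [if_pos (by omega)]
      · rintro ⟨i, j⟩ hx
        refine if_neg fun hlt => hx ⟨(j, (m (j - 1) - 1 - i).toNat), ?_⟩
        simp only at hlt
        simp only [Prod.mk.injEq, and_true]
        omega
    refine Summable.of_nonneg_of_le (fun _ => sq_nonneg _) (fun x => ?_) hs
    by_cases h1 : x.1 < m (x.2 - 1)
    · rw [if_pos h1]
      split_ifs
      · rw [norm_mul, norm_pow, mul_pow, ← pow_mul, ← pow_mul, mul_comm 2]
      · rw [norm_zero, zero_pow two_ne_zero]; positivity
    · simp [h1]) (fun i j hij => if_neg fun h => hij h.1)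
  have hBA : (lam • ContinuousLinearMap.id ℂ (HJ J) - Mz hJ) f
      = (μ • ContinuousLinearMap.id ℂ (HJ J) - Mw hJ) g := by
    refine cf_ext fun i j => ?_
    simp only [sub_apply, smul_apply,
      ContinuousLinearMap.id_apply, cf_sub, cf_smul, cf_Mz, cf_Mw, hf, hg]
    by_cases hj' : j - 1 ∈ F
    -- The coefficient identity for the full geometric series, before it is cut off at m j.
    · have hstep : μ * (if i < m (j - 1) then p (j - 1) * μ ^ (m (j - 1) - 1 - i).toNat else 0)
          + (if i = m (j - 1) then p (j - 1) else 0)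
          = if i ≤ m (j - 1) then p (j - 1) * μ ^ (m (j - 1) - i).toNat else 0 := by
        rcases lt_trichotomy i (m (j - 1)) with h | h | h
        · have e : (m (j - 1) - i).toNat = (m (j - 1) - 1 - i).toNat + 1 := by omega
          rw [if_pos h, if_neg h.ne, if_pos h.le, e]; ring
        · simp [h]
        · rw [if_neg (by omega), if_neg (by omega), if_neg (by omega)]; ring
      have e1 : m (j - 1) - 1 - (i - 1) = m (j - 1) - i := by ring
      have e2 : i - 1 < m (j - 1) ↔ i ≤ m (j - 1) := by omega
      simp only [e1, e2]
      by_cases hj : j ∈ F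
      · have hanti : m j ≤ m (j - 1) := by
          simpa using hb.antitone hJ hj' (n := 1) (by simpa using hj)
        have hnj := hnull j
        rw [shiftWeight, sub_add_cancel, if_pos ⟨hj', hj⟩] at hnj
        rw [hb.mem_iff j hj, hb.mem_iff j hj]
        rcases lt_trichotomy i (m j) with h | h | h
        · rw [if_neg h.ne, if_neg (by omega), if_neg (by omega), if_neg (by omega)]; ring
        · rw [if_pos h, if_neg (show ¬ (m j ≤ i - 1 ∧ i ≤ m (j - 1)) by omega), hnj]
          simp only [h, le_refl, true_and] at hstep ⊢
          rw [if_pos hanti] at hstep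
          linear_combination -hstep
        · rw [if_neg h.ne']
          have e3 : (m j ≤ i ∧ i < m (j - 1)) ↔ i < m (j - 1) := by omega
          have e4 : (m j ≤ i - 1 ∧ i ≤ m (j - 1)) ↔ i ≤ m (j - 1) := by omega
          simp only [e3, e4]
          linear_combination -hstep
      · have hfull : ∀ i, (i, j) ∈ J := by
          refine (hb.full_or_empty j hj).resolve_right fun he => he (m (j - 1)) ?_
          simpa using hJ (m (j - 1)) (j - 1) ((hb.mem_iff _ hj' _).mpr le_rfl) 0 1
        simp only [hfull, true_and, hpF j hj, ite_self]
        linear_combination -hstep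
    · have h0 : shiftWeight μ F m (j - 1) = 0 := by
        by_contra hne; exact hj' (shiftWeight_ne_zero hne).1
      have hnj := hnull j
      rw [h0, zero_mul] at hnj
      simp only [hpF _ hj', zero_mul, ite_self, mul_ite, mul_zero, hnj, sub_self]
  obtain ⟨h, hA, -⟩ := KoszulExact.exists_of_eq hex hBA
  funext j
  by_cases hj : j ∈ F
  · have hn : (m j - 1, j) ∉ J := by rw [hb.mem_iff j hj]; omega
    have h1 := congrArg (rowEval μ (m j) j) hA
    simp only [sub_apply, smul_apply,
      ContinuousLinearMap.id_apply, rowEval_sub hμ, rowEval_smul, rowEval_Mw hJ hμ hn,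
      sub_self] at h1
    rw [rowEval, tsum_eq_single 0] at h1
    · simpa [hf] using h1.symm
    · intro t ht
      rw [hf, if_neg (by omega), zero_mul]
  · exact hpF j hj

/-- If the Koszul complex is exact at `(μ, lam)` with `|μ| < 1`, then `|lam|` is separated from the
geometric means of the weights over windows of some fixed length. -/
theorem KoszulExactAt.dichotomy {hJ : IsDiagram J} (hex : KoszulExactAt hJ μ lam)
    (hb : IsBorder J F m) (hF : F.Nonempty) (hμ : ‖μ‖ < 1) :
    (lam ≠ 0 ∧ ∃ n ≥ 1, ∀ k : ℤ,
      ∏ i ∈ Finset.range n, ‖shiftWeight μ F m (k + (i : ℕ))‖ < ‖lam‖ ^ n) ∨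
    ((∀ j, shiftWeight μ F m j ≠ 0) ∧ (∃ ε > 0, ∀ k, ε ≤ ‖shiftWeight μ F m k‖) ∧
      ∃ n ≥ 1, ∀ k : ℤ,
        ‖lam‖ ^ n < ∏ i ∈ Finset.range n, ‖shiftWeight μ F m (k + (i : ℕ))‖) := by
  obtain ⟨K, hK⟩ := hex.exists_shiftSol hb hμ
  exact weightedShift_dichotomy hF (fun j => shiftWeight_ne_zero) hK
    fun p h1 h2 h3 => hex.eq_zero_of_null hb hμ h1 h2 h3

theorem prod_norm_shiftWeight (hb : IsBorder J F m) (hJ : IsDiagram J) {k : ℤ} {n : ℕ}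
    (h : ∀ i ≤ n, k + (i : ℕ) ∈ F) :
    ∏ i ∈ Finset.range n, ‖shiftWeight μ F m (k + (i : ℕ))‖
      = ‖μ‖ ^ (m k - m (k + n)).toNat := by
  induction n with
  | zero => simp
  | succ n ih =>
    have h1 := h n (by omega)
    have h2 := h (n + 1) le_rfl
    have e : k + ((n + 1 : ℕ) : ℤ) = k + n + 1 := by push_cast; ring
    rw [e] at h2
    have h3 := hb.antitone hJ (by simpa using h 0 (by omega)) h1
    have h4 := hb.antitone hJ h1 (n := 1) (by simpa using h2)
    rw [Finset.prod_range_succ, ih fun i hi => h i (by omega), shiftWeight, if_pos ⟨h1, h2⟩,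
      norm_pow, ← pow_add, e]
    congr 1
    push_cast at h4
    omega

end RowEvaluation

/-! ### Approximate joint eigenvectors of the adjoints -/

section Window

variable {J : Set (ℤ × ℤ)} {μ lam : ℂ}

theorem sum_pow_mul_norm_cf_le (f : HJ J) (r : ℝ) {ι : ℕ → ℤ × ℤ} (hι : ι.Injective) (n : ℕ) :
    ∑ l ∈ Finset.range n, r ^ l * ‖cf f (ι l).1 (ι l).2‖
      ≤ √(∑ l ∈ Finset.range n, (r ^ l) ^ 2) * ‖f‖ := by
  have h := Real.sum_mul_le_sqrt_mul_sqrt (Finset.range n) (fun l => r ^ l)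
    (fun l => ‖cf f (ι l).1 (ι l).2‖)
  refine h.trans ?_
  gcongr
  have h1 := hasSum_norm_cf_sq f
  have h2 := h1.summable.sum_le_tsum ((Finset.range n).map ⟨ι, hι⟩) fun _ _ => sq_nonneg _
  rw [h1.tsum_eq, Finset.sum_map] at h2
  exact Real.sqrt_le_iff.mpr ⟨norm_nonneg f, h2⟩

/-- Pairing with the polynomial with coefficients `conj (μ ^ i lam ^ l)` on an `N × L` window. -/
def windowSum (μ lam : ℂ) (N L : ℕ) (i₀ j₀ : ℤ) (f : HJ J) : ℂ :=
  ∑ i ∈ Finset.range N, ∑ l ∈ Finset.range L, μ ^ i * lam ^ l * cf f (i₀ + i) (j₀ + l)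

theorem sum_pow_telescope (c : ℂ) (a : ℤ → ℂ) (n : ℕ) (i₀ : ℤ) :
    ∑ i ∈ Finset.range n, c ^ i * (c * a (i₀ + i) - a (i₀ + i - 1))
      = c ^ n * a (i₀ + n - 1) - a (i₀ - 1) := by
  induction n with
  | zero => simp
  | succ n ih =>
    rw [Finset.sum_range_succ, ih]
    have : i₀ + ((n + 1 : ℕ) : ℤ) - 1 = i₀ + n := by push_cast; ring
    rw [this]; ring

/-- Telescoping in the horizontal direction leaves only the two boundary columns, both of weight 1
because |μ| = 1. -/
theorem norm_windowSum_w_le (hJ : IsDiagram J) (hμ : ‖μ‖ = 1) (N L : ℕ) (i₀ j₀ : ℤ) (f : HJ J) :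
    ‖windowSum μ lam N L i₀ j₀ ((μ • ContinuousLinearMap.id ℂ (HJ J) - Mw hJ) f)‖
      ≤ 2 * √(∑ l ∈ Finset.range L, (‖lam‖ ^ l) ^ 2) * ‖f‖ := by
  have e : windowSum μ lam N L i₀ j₀ ((μ • ContinuousLinearMap.id ℂ (HJ J) - Mw hJ) f)
      = ∑ l ∈ Finset.range L, lam ^ l *
        (μ ^ N * cf f (i₀ + N - 1) (j₀ + l) - cf f (i₀ - 1) (j₀ + l)) := by
    rw [windowSum, Finset.sum_comm]
    refine Finset.sum_congr rfl fun l _ => ?_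
    rw [← sum_pow_telescope μ (fun i => cf f i (j₀ + l)), Finset.mul_sum]
    refine Finset.sum_congr rfl fun i _ => ?_
    simp only [sub_apply, smul_apply,
      ContinuousLinearMap.id_apply, cf_sub, cf_smul, cf_Mw]
    ring
  have hι (a : ℤ) : Function.Injective fun l : ℕ => (a, j₀ + (l : ℤ)) := fun s t h => by
    simpa using h
  have h1 := sum_pow_mul_norm_cf_le f ‖lam‖ (hι (i₀ + N - 1)) L
  have h2 := sum_pow_mul_norm_cf_le f ‖lam‖ (hι (i₀ - 1)) L
  rw [e]
  refine (norm_sum_le _ _).trans ?_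
  calc _ ≤ ∑ l ∈ Finset.range L, (‖lam‖ ^ l * ‖cf f (i₀ + N - 1) (j₀ + l)‖
        + ‖lam‖ ^ l * ‖cf f (i₀ - 1) (j₀ + l)‖) := by
        refine Finset.sum_le_sum fun l _ => ?_
        rw [norm_mul, norm_pow, ← mul_add]
        gcongr
        refine (norm_sub_le _ _).trans ?_
        rw [norm_mul, norm_pow, hμ, one_pow, one_mul]
    _ ≤ _ := by
        rw [Finset.sum_add_distrib]
        simp only at h1 h2
        linarith

/-- Telescoping vertically leaves the top row, damped by λ^L, and the row just below the window; ε =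
0 records that the latter lies outside J. -/
theorem norm_windowSum_z_le (hJ : IsDiagram J) (hμ : ‖μ‖ = 1) {N : ℕ} (L : ℕ) {i₀ j₀ : ℤ} {ε : ℝ}
    (hε : ε = 1 ∨ ε = 0 ∧ ∀ i < N, (i₀ + (i : ℕ), j₀ - 1) ∉ J) (f : HJ J) :
    ‖windowSum μ lam N L i₀ j₀ ((lam • ContinuousLinearMap.id ℂ (HJ J) - Mz hJ) f)‖
      ≤ (‖lam‖ ^ L + ε) * √N * ‖f‖ := by
  have e : windowSum μ lam N L i₀ j₀ ((lam • ContinuousLinearMap.id ℂ (HJ J) - Mz hJ) f)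
      = ∑ i ∈ Finset.range N, μ ^ i *
        (lam ^ L * cf f (i₀ + i) (j₀ + L - 1) - cf f (i₀ + i) (j₀ - 1)) := by
    rw [windowSum]
    refine Finset.sum_congr rfl fun i _ => ?_
    rw [← sum_pow_telescope lam (fun j => cf f (i₀ + i) j), Finset.mul_sum]
    refine Finset.sum_congr rfl fun l _ => ?_
    simp only [sub_apply, smul_apply,
      ContinuousLinearMap.id_apply, cf_sub, cf_smul, cf_Mz]
    ring
  have hι (b : ℤ) : Function.Injective fun i : ℕ => (i₀ + (i : ℤ), b) := fun s t h => by
    simpa using h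
  have h1 := sum_pow_mul_norm_cf_le f 1 (hι (j₀ + L - 1)) N
  have h2 := sum_pow_mul_norm_cf_le f 1 (hι (j₀ - 1)) N
  simp only [one_pow, one_mul, Finset.sum_const, Finset.card_range, nsmul_eq_mul, mul_one]
    at h1 h2
  have h3 : ∑ i ∈ Finset.range N, ‖cf f (i₀ + i) (j₀ - 1)‖ ≤ ε * (√N * ‖f‖) := by
    rcases hε with rfl | ⟨rfl, h⟩
    · simpa using h2
    · rw [Finset.sum_eq_zero, zero_mul]
      intro i hi
      rw [cf_eq_zero f (h i (Finset.mem_range.mp hi)), norm_zero]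
  rw [e]
  refine (norm_sum_le _ _).trans ?_
  calc _ ≤ ∑ i ∈ Finset.range N, (‖lam‖ ^ L * ‖cf f (i₀ + i) (j₀ + L - 1)‖
        + ‖cf f (i₀ + i) (j₀ - 1)‖) := by
        refine Finset.sum_le_sum fun l _ => ?_
        rw [norm_mul, norm_pow, hμ, one_pow, one_mul]
        refine (norm_sub_le _ _).trans ?_
        rw [norm_mul, norm_pow]
    _ ≤ ‖lam‖ ^ L * (√N * ‖f‖) + ε * (√N * ‖f‖) := by
        rw [Finset.sum_add_distrib, ← Finset.mul_sum]
        gcongr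
    _ = _ := by ring

/-- The coefficients of g are the conjugates of those in the functional, so the functional at g is
‖g‖². -/
theorem exists_window (hμ : ‖μ‖ = 1) {N L : ℕ} {i₀ j₀ : ℤ}
    (hJw : ∀ i < N, ∀ l < L, (i₀ + (i : ℕ), j₀ + (l : ℕ)) ∈ J) :
    ∃ g : HJ J, windowSum μ lam N L i₀ j₀ g = ((‖g‖ ^ 2 : ℝ) : ℂ) ∧
      ‖g‖ ^ 2 = N * ∑ l ∈ Finset.range L, (‖lam‖ ^ l) ^ 2 := by
  set s := (Finset.range N ×ˢ Finset.range L).map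
    ⟨fun x : ℕ × ℕ => (i₀ + (x.1 : ℤ), j₀ + (x.2 : ℤ)), fun x y h => by
      simpa [Prod.ext_iff] using h⟩ with hs
  have hmem (i l : ℕ) : (i₀ + (i : ℤ), j₀ + (l : ℤ)) ∈ s ↔ i < N ∧ l < L := by
    simp only [hs, Finset.mem_map, Finset.mem_product, Finset.mem_range, Prod.exists]
    constructor
    · rintro ⟨a, b, h, he⟩
      have h1 : i₀ + (a : ℤ) = i₀ + i := congrArg Prod.fst he
      have h2 : j₀ + (b : ℤ) = j₀ + l := congrArg Prod.snd he
      omega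
    · exact fun h => ⟨i, l, h, rfl⟩
  obtain ⟨g, hg⟩ := exists_cf_eq (J := J) (c := fun i j => if (i, j) ∈ s then
      starRingEnd ℂ (μ ^ (i - i₀).toNat * lam ^ (j - j₀).toNat) else 0)
    (summable_of_ne_finset_zero (s := s) fun x hx => by
      simp only [if_neg hx, norm_zero, ne_eq, OfNat.ofNat_ne_zero, not_false_eq_true, zero_pow])
    (fun i j hij => if_neg fun h => hij (by
      obtain ⟨⟨a, b⟩, hab, he⟩ := Finset.mem_map.mp h
      rw [Finset.mem_product, Finset.mem_range, Finset.mem_range] at hab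
      rw [← he]; exact hJw a hab.1 b hab.2))
  have hgc (i l : ℕ) (hi : i < N) (hl : l < L) :
      cf g (i₀ + i) (j₀ + l) = starRingEnd ℂ (μ ^ i * lam ^ l) := by
    rw [hg, if_pos ((hmem i l).mpr ⟨hi, hl⟩)]; simp
  have hnorm : ‖g‖ ^ 2 = ∑ i ∈ Finset.range N, ∑ l ∈ Finset.range L,
      ‖cf g (i₀ + i) (j₀ + l)‖ ^ 2 := by
    have h1 := hasSum_norm_cf_sq g
    have h2 : HasSum (fun x : ℤ × ℤ => ‖cf g x.1 x.2‖ ^ 2) (∑ x ∈ s, ‖cf g x.1 x.2‖ ^ 2) :=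
      hasSum_sum_of_ne_finset_zero fun x hx => by rw [hg, if_neg hx]; simp
    rw [h1.unique h2, hs, Finset.sum_map, Finset.sum_product]
    rfl
  refine ⟨g, ?_, ?_⟩
  · rw [hnorm, windowSum]
    push_cast
    refine Finset.sum_congr rfl fun i hi => Finset.sum_congr rfl fun l hl => ?_
    rw [hgc i l (Finset.mem_range.mp hi) (Finset.mem_range.mp hl), Complex.mul_conj']
    rw [RCLike.norm_conj]
  · rw [hnorm, ← nsmul_eq_mul]
    conv_rhs => rw [← Finset.card_range N, ← Finset.sum_const]
    refine Finset.sum_congr rfl fun i hi => Finset.sum_congr rfl fun l hl => ?_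
    rw [hgc i l (Finset.mem_range.mp hi) (Finset.mem_range.mp hl), RCLike.norm_conj, norm_mul,
      norm_pow, norm_pow, hμ, one_pow, one_mul]

/-- Pair the window polynomial g with its own decomposition (μ - M_w) f₂ - (λ - M_z) f₁, where ‖f₁‖,
‖f₂‖ ≤ C ‖g‖. Only boundary terms survive, and a factor ‖g‖ cancels. -/
theorem KoszulExactAt.exists_window_bound {hJ : IsDiagram J} (hex : KoszulExactAt hJ μ lam)
    (hμ : ‖μ‖ = 1) :
    ∃ C > 0, ∀ (N L : ℕ) (i₀ j₀ : ℤ) (ε : ℝ),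
      (∀ i < N, ∀ l < L, (i₀ + (i : ℕ), j₀ + (l : ℕ)) ∈ J) →
      (ε = 1 ∨ ε = 0 ∧ ∀ i < N, (i₀ + (i : ℕ), j₀ - 1) ∉ J) →
      √N * √(∑ l ∈ Finset.range L, (‖lam‖ ^ l) ^ 2)
        ≤ C * (2 * √(∑ l ∈ Finset.range L, (‖lam‖ ^ l) ^ 2) + (‖lam‖ ^ L + ε) * √N) := by
  obtain ⟨C, hC, hs⟩ := KoszulExact.exists_preimage hex
  refine ⟨C, hC, fun N L i₀ j₀ ε hw hε => ?_⟩
  obtain ⟨g, hg1, hg2⟩ := exists_window (lam := lam) hμ hw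
  set S := ∑ l ∈ Finset.range L, (‖lam‖ ^ l) ^ 2 with hS
  have hε0 : 0 ≤ ε := by rcases hε with rfl | ⟨rfl, -⟩ <;> norm_num
  obtain ⟨f₁, f₂, hf, h1, h2⟩ := hs g
  have hsub : windowSum μ lam N L i₀ j₀ g
      = windowSum μ lam N L i₀ j₀ ((μ • ContinuousLinearMap.id ℂ (HJ J) - Mw hJ) f₂)
        - windowSum μ lam N L i₀ j₀ ((lam • ContinuousLinearMap.id ℂ (HJ J) - Mz hJ) f₁) := by
    conv_lhs => rw [← hf]
    simp only [windowSum, ← Finset.sum_sub_distrib, ← mul_sub]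
    refine Finset.sum_congr rfl fun i _ => Finset.sum_congr rfl fun l _ => ?_
    rw [cf_sub]
  have hb : ‖g‖ ^ 2 ≤ 2 * √S * ‖f₂‖ + (‖lam‖ ^ L + ε) * √N * ‖f₁‖ := by
    have h3 := congrArg norm hg1
    rw [Complex.norm_real, Real.norm_of_nonneg (sq_nonneg _)] at h3
    rw [← h3, hsub]
    exact (norm_sub_le _ _).trans
      (add_le_add (norm_windowSum_w_le hJ hμ N L i₀ j₀ f₂) (norm_windowSum_z_le hJ hμ L hε f₁))
  have hgn : ‖g‖ = √N * √S := by
    rw [← Real.sqrt_mul (Nat.cast_nonneg N), ← hg2, Real.sqrt_sq (norm_nonneg g)]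
  rw [← hgn]
  by_cases h0 : ‖g‖ = 0
  · rw [h0]; positivity
  have hpos : 0 < ‖g‖ := lt_of_le_of_ne (norm_nonneg g) (Ne.symm h0)
  have : ‖g‖ * ‖g‖ ≤ C * (2 * √S + (‖lam‖ ^ L + ε) * √N) * ‖g‖ := by
    rw [← sq]
    refine hb.trans ?_
    calc _ ≤ 2 * √S * (C * ‖g‖) + (‖lam‖ ^ L + ε) * √N * (C * ‖g‖) := by gcongr
      _ = _ := by ring
  exact le_of_mul_le_mul_right this hpos

theorem not_koszulExactAt_of_norm_eq_one (hJ : IsDiagram J) (hne : J.Nonempty) (hμ : ‖μ‖ = 1)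
    (hl : ‖lam‖ = 1) : ¬ KoszulExactAt hJ μ lam := by
  intro hex
  obtain ⟨C, hC, h⟩ := hex.exists_window_bound hμ
  obtain ⟨⟨i, j⟩, hij⟩ := hne
  -- For an N × N window the bound reads N ≤ 4 C √N.
  obtain ⟨N, hN⟩ := exists_nat_gt ((4 * C) ^ 2)
  have h1 := h N N i j 1 (fun a _ b _ => hJ i j hij a b) (Or.inl rfl)
  simp only [hl, one_pow, Finset.sum_const, Finset.card_range, nsmul_eq_mul, mul_one] at h1
  have hlt : 4 * C < √N := Real.lt_sqrt_of_sq_lt hN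
  nlinarith [Real.sqrt_nonneg N]

theorem not_koszulExactAt_of_long_edges (hJ : IsDiagram J) (hμ : ‖μ‖ = 1) (hl : ‖lam‖ < 1)
    (hedge : ∀ N : ℕ, ∃ i j : ℤ, ∀ t < N, (i + (t : ℕ), j) ∈ J ∧ (i + (t : ℕ), j - 1) ∉ J) :
    ¬ KoszulExactAt hJ μ lam := by
  intro hex
  obtain ⟨C, hC, h⟩ := hex.exists_window_bound hμ
  obtain ⟨N, hN⟩ := exists_nat_gt ((4 * C) ^ 2)
  have hlt : 4 * C < √N := Real.lt_sqrt_of_sq_lt hN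
  -- L makes the top row cost at most half of √N, while √N > 4C makes the two sides cost less than
  -- half of √N √S. As √S ≥ 1, the bound fails.
  obtain ⟨L, hL⟩ := exists_pow_lt_of_lt_one (show 0 < 1 / (2 * C) by positivity) hl
  obtain ⟨i, j, hij⟩ := hedge N
  have h1 := h N (L + 1) i j 0
    (fun a ha b _ => by simpa using hJ _ _ (hij a ha).1 0 b) (Or.inr ⟨rfl, fun a ha => (hij a ha).2⟩)
  set S := ∑ l ∈ Finset.range (L + 1), (‖lam‖ ^ l) ^ 2
  have hS : 1 ≤ √S := by
    rw [Real.one_le_sqrt]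
    refine le_trans ?_ (Finset.single_le_sum (f := fun l => (‖lam‖ ^ l) ^ 2)
      (fun _ _ => sq_nonneg _) (Finset.mem_range.mpr (Nat.succ_pos L)))
    simp
  have hpow : C * ‖lam‖ ^ (L + 1) ≤ 1 / 2 := by
    have h2 : ‖lam‖ ^ (L + 1) ≤ ‖lam‖ ^ L := pow_le_pow_of_le_one (norm_nonneg _) hl.le (by omega)
    calc C * ‖lam‖ ^ (L + 1) ≤ C * (1 / (2 * C)) := by gcongr; linarith
      _ = 1 / 2 := by field_simp
  have h3 : √N * √S ≤ 2 * C * √S + 1 / 2 * √N := by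
    refine h1.trans ?_
    rw [add_zero]
    nlinarith [Real.sqrt_nonneg N]
  nlinarith [Real.sqrt_nonneg N, mul_le_mul_of_nonneg_left hS (Real.sqrt_nonneg N)]

end Window

/-! ### Growth rates of a nonnegative cocycle -/

section Slopes

/-- A nonnegative additive cocycle over the translation by `ε`, on an invariant set `S` of
integers. -/
structure IsSlopeCocycle (S : Set ℤ) (ε : ℤ) (D : ℤ → ℕ → ℝ) : Prop where
  nonempty : S.Nonempty
  step : ∀ j ∈ S, ∀ n : ℕ, j + ε * n ∈ S
  add : ∀ j ∈ S, ∀ a b : ℕ, D j (a + b) = D j a + D (j + ε * a) b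
  nonneg : ∀ j ∈ S, ∀ n, 0 ≤ D j n

namespace IsSlopeCocycle

variable {S : Set ℤ} {ε : ℤ} {D : ℤ → ℕ → ℝ}

theorem mono (h : IsSlopeCocycle S ε D) {j : ℤ} (hj : j ∈ S) {a b : ℕ} (hab : a ≤ b) :
    D j a ≤ D j b := by
  obtain ⟨c, rfl⟩ := Nat.exists_eq_add_of_le hab
  rw [h.add j hj]
  linarith [h.nonneg _ (h.step j hj a) c]

theorem apply_zero (h : IsSlopeCocycle S ε D) {j : ℤ} (hj : j ∈ S) : D j 0 = 0 := by
  have := h.add j hj 0 0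
  simp at this
  exact this

theorem apply_mul_le (h : IsSlopeCocycle S ε D) {c : ℝ} {m : ℕ} (hc : ∀ j ∈ S, D j m ≤ c * m)
    (q : ℕ) {j : ℤ} (hj : j ∈ S) : D j (q * m) ≤ c * (q * m) := by
  induction q with
  | zero => simp [h.apply_zero hj]
  | succ q ih =>
    rw [Nat.succ_mul, h.add j hj]
    have := hc _ (h.step j hj (q * m))
    push_cast at this ⊢
    linarith

theorem le_apply_mul (h : IsSlopeCocycle S ε D) {c : ℝ} {m : ℕ} (hc : ∀ j ∈ S, c * m ≤ D j m)
    (q : ℕ) {j : ℤ} (hj : j ∈ S) : c * (q * m) ≤ D j (q * m) := by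
  induction q with
  | zero => simp [h.apply_zero hj]
  | succ q ih =>
    rw [Nat.succ_mul, h.add j hj]
    have := hc _ (h.step j hj (q * m))
    push_cast at this ⊢
    linarith

/-- Cut n into blocks of length m; by monotonicity the incomplete block costs no more than a whole
one. -/
theorem apply_le (h : IsSlopeCocycle S ε D) {c : ℝ} {m : ℕ} (hm : 1 ≤ m)
    (hc : ∀ j ∈ S, D j m ≤ c * m) (n : ℕ) {j : ℤ} (hj : j ∈ S) : D j n ≤ c * n + c * m := by
  have hm' : (0 : ℝ) < m := by exact_mod_cast hm
  have hc0 : 0 ≤ c := by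
    have := (h.nonneg j hj m).trans (hc j hj)
    exact nonneg_of_mul_nonneg_left this hm'
  have e := Nat.div_add_mod' n m
  have h1 := h.apply_mul_le hc (n / m) hj
  have h2 := (h.mono (h.step j hj (n / m * m)) (Nat.mod_lt n hm).le).trans
    (hc _ (h.step j hj (n / m * m)))
  have h3 : ((n / m : ℕ) * m : ℝ) ≤ n := by exact_mod_cast Nat.div_mul_le_self n m
  calc D j n = D j (n / m * m + n % m) := by rw [e]
    _ = D j (n / m * m) + D (j + ε * (n / m * m : ℕ)) (n % m) := h.add j hj _ _
    _ ≤ c * n + c * m := add_le_add (h1.trans (by gcongr)) h2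

theorem le_apply (h : IsSlopeCocycle S ε D) {c : ℝ} (hc0 : 0 ≤ c) {m : ℕ} (hm : 1 ≤ m)
    (hc : ∀ j ∈ S, c * m ≤ D j m) (n : ℕ) {j : ℤ} (hj : j ∈ S) : c * n - c * m ≤ D j n := by
  have h1 := (h.le_apply_mul hc (n / m) hj).trans (h.mono hj (Nat.div_mul_le_self n m))
  have h3 : (n : ℝ) - m ≤ (n / m : ℕ) * m := by
    have := Nat.div_add_mod' n m
    have := Nat.mod_lt n hm
    rw [sub_le_iff_le_add]
    exact_mod_cast (show n ≤ n / m * m + m by omega)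
  refine le_trans ?_ h1
  rw [← mul_sub]
  gcongr

/-- Fekete's argument: a bound c at one length m gives c + c m / n at every length n, so the limit
is the infimum. -/
theorem tendsto_iSup (h : IsSlopeCocycle S ε D) :
    Tendsto (fun n : ℕ => ⨆ j ∈ S, ((D j n / n : ℝ) : EReal)) atTop
      (𝓝 (⨅ (n : ℕ) (_ : 1 ≤ n), ⨆ j ∈ S, ((D j n / n : ℝ) : EReal))) := by
  refine tendsto_order.mpr ⟨fun a ha => ?_, fun a ha => ?_⟩
  · filter_upwards [eventually_ge_atTop 1] with n hn
    exact ha.trans_le (iInf₂_le n hn)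
  · obtain ⟨m, hm⟩ := iInf_lt_iff.mp ha
    obtain ⟨hm1, hm⟩ := iInf_lt_iff.mp hm
    obtain ⟨c, hc1, hc⟩ := EReal.lt_iff_exists_real_btwn.mp hm
    obtain ⟨c', hc2, hc3⟩ := EReal.lt_iff_exists_real_btwn.mp hc
    have hcc : c < c' := EReal.coe_lt_coe_iff.mp hc2
    have hm' : (0 : ℝ) < m := by exact_mod_cast hm1
    have hD : ∀ j ∈ S, D j m ≤ c * m := fun j hj => by
      rw [← div_le_iff₀ hm']
      exact EReal.coe_le_coe_iff.mp ((le_iSup₂ (f := fun j _ => ((D j m / m : ℝ) : EReal)) j hj).trans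
        hc1.le)
    filter_upwards [eventually_ge_atTop 1, eventually_ge_atTop ⌈c * m / (c' - c)⌉₊] with n hn1 hn
    have hn' : (0 : ℝ) < n := by exact_mod_cast hn1
    refine lt_of_le_of_lt (iSup₂_le fun j hj => EReal.coe_le_coe_iff.mpr ?_) hc3
    rw [div_le_iff₀ hn']
    have h1 := h.apply_le hm1 hD n hj
    have h2 := Nat.ceil_le.mp hn
    rw [div_le_iff₀ (by linarith)] at h2
    linarith

theorem tendsto_iInf (h : IsSlopeCocycle S ε D) :
    Tendsto (fun n : ℕ => ⨅ j ∈ S, ((D j n / n : ℝ) : EReal)) atTop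
      (𝓝 (⨆ (n : ℕ) (_ : 1 ≤ n), ⨅ j ∈ S, ((D j n / n : ℝ) : EReal))) := by
  refine tendsto_order.mpr ⟨fun a ha => ?_, fun a ha => ?_⟩
  · obtain ⟨m, hm⟩ := lt_iSup_iff.mp ha
    obtain ⟨hm1, hm⟩ := lt_iSup_iff.mp hm
    obtain ⟨c, hc, hc1⟩ := EReal.lt_iff_exists_real_btwn.mp hm
    obtain ⟨c', hc3, hc2⟩ := EReal.lt_iff_exists_real_btwn.mp hc
    have hcc : c' < c := EReal.coe_lt_coe_iff.mp hc2
    have hm' : (0 : ℝ) < m := by exact_mod_cast hm1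
    have hD : ∀ j ∈ S, c * m ≤ D j m := fun j hj => by
      rw [← le_div_iff₀ hm']
      exact EReal.coe_le_coe_iff.mp (hc1.le.trans (iInf₂_le (f := fun j _ => ((D j m / m : ℝ) : EReal))
        j hj))
    filter_upwards [eventually_ge_atTop 1, eventually_ge_atTop ⌈c * m / (c - c')⌉₊] with n hn1 hn
    have hn' : (0 : ℝ) < n := by exact_mod_cast hn1
    refine lt_of_lt_of_le hc3 (le_iInf₂ fun j hj => EReal.coe_le_coe_iff.mpr ?_)
    rw [le_div_iff₀ hn']
    rcases le_or_gt 0 c with hc0 | hc0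
    · have h1 := h.le_apply hc0 hm1 hD n hj
      have h2 := Nat.ceil_le.mp hn
      rw [div_le_iff₀ (by linarith)] at h2
      linarith
    -- A negative c needs no block estimate: c' < c < 0 ≤ D j n.
    · have := h.nonneg j hj n
      nlinarith
  · filter_upwards [eventually_ge_atTop 1] with n hn
    exact (le_iSup₂ (f := fun (n : ℕ) (_ : 1 ≤ n) => ⨅ j ∈ S, ((D j n / n : ℝ) : EReal)) n hn).trans_lt
      ha

/-- `L` and `l` are the upper and lower growth rates of the cocycle. -/
structure HasRates (S : Set ℤ) (D : ℤ → ℕ → ℝ) (L l : EReal) : Prop where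
  nonneg_upper : 0 ≤ L
  nonneg_lower : 0 ≤ l
  upper_le : ∀ {n : ℕ} {a : ℝ}, 1 ≤ n → (∀ j ∈ S, D j n ≤ a) → L ≤ ((a / n : ℝ) : EReal)
  le_lower : ∀ {n : ℕ} {b : ℝ}, 1 ≤ n → (∀ j ∈ S, b ≤ D j n) → ((b / n : ℝ) : EReal) ≤ l
  of_upper_lt : ∀ {r : ℝ}, L < r → ∃ K ≥ 0, ∀ (n : ℕ), ∀ j ∈ S, D j n ≤ r * n + K
  of_lt_lower : ∀ {r : ℝ}, 0 ≤ r → r < l → ∃ K ≥ 0, ∀ (n : ℕ), ∀ j ∈ S, r * n - K ≤ D j n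

theorem hasRates (h : IsSlopeCocycle S ε D) :
    HasRates S D (⨅ (n : ℕ) (_ : 1 ≤ n), ⨆ j ∈ S, ((D j n / n : ℝ) : EReal))
      (⨆ (n : ℕ) (_ : 1 ≤ n), ⨅ j ∈ S, ((D j n / n : ℝ) : EReal)) where
  nonneg_upper := by
    obtain ⟨j, hj⟩ := h.nonempty
    refine le_iInf₂ fun n _ => le_trans ?_
      (le_iSup₂ (f := fun j _ => ((D j n / n : ℝ) : EReal)) j hj)
    exact EReal.coe_nonneg.mpr (div_nonneg (h.nonneg j hj n) (Nat.cast_nonneg n))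
  nonneg_lower := by
    refine le_trans ?_ (le_iSup₂ (f := fun (n : ℕ) (_ : 1 ≤ n) => ⨅ j ∈ S,
      ((D j n / n : ℝ) : EReal)) 1 le_rfl)
    exact le_iInf₂ fun j hj =>
      EReal.coe_nonneg.mpr (div_nonneg (h.nonneg j hj 1) (Nat.cast_nonneg 1))
  upper_le := fun {n a} hn ha => (iInf₂_le n hn).trans <| iSup₂_le fun j hj =>
    EReal.coe_le_coe_iff.mpr (by have := ha j hj; gcongr)
  le_lower := fun {n b} hn hb => le_trans (le_iInf₂ fun j hj =>
    EReal.coe_le_coe_iff.mpr (by have := hb j hj; gcongr))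
      (le_iSup₂ (f := fun (n : ℕ) (_ : 1 ≤ n) => ⨅ j ∈ S, ((D j n / n : ℝ) : EReal)) n hn)
  of_upper_lt := fun {r} hr => by
    obtain ⟨m, hm⟩ := iInf_lt_iff.mp hr
    obtain ⟨hm1, hm⟩ := iInf_lt_iff.mp hm
    have hm' : (0 : ℝ) < m := by exact_mod_cast hm1
    have hD : ∀ j ∈ S, D j m ≤ r * m := fun j hj => by
      rw [← div_le_iff₀ hm']
      exact EReal.coe_le_coe_iff.mp
        ((le_iSup₂ (f := fun j _ => ((D j m / m : ℝ) : EReal)) j hj).trans hm.le)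
    refine ⟨r * m, ?_, fun n j hj => h.apply_le hm1 hD n hj⟩
    obtain ⟨j, hj⟩ := h.nonempty
    exact (h.nonneg j hj m).trans (hD j hj)
  of_lt_lower := fun {r} hr0 hr => by
    obtain ⟨m, hm⟩ := lt_iSup_iff.mp hr
    obtain ⟨hm1, hm⟩ := lt_iSup_iff.mp hm
    have hm' : (0 : ℝ) < m := by exact_mod_cast hm1
    have hD : ∀ j ∈ S, r * m ≤ D j m := fun j hj => by
      rw [← le_div_iff₀ hm']
      exact EReal.coe_le_coe_iff.mp
        (hm.le.trans (iInf₂_le (f := fun j _ => ((D j m / m : ℝ) : EReal)) j hj))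
    exact ⟨r * m, by positivity, fun n j hj => h.le_apply hr0 hm1 hD n hj⟩

end IsSlopeCocycle

end Slopes

/-! ### Rows of a diagram -/

section Rows

variable {J : Set (ℤ × ℤ)} {F : Set ℤ} {m : ℤ → ℤ}

theorem IsDiagram.mem_of_le (hJ : IsDiagram J) {i j i' j' : ℤ} (h : (i, j) ∈ J) (hi : i ≤ i')
    (hj : j ≤ j') : (i', j') ∈ J := by
  obtain ⟨a, rfl⟩ := Int.le.dest hi
  obtain ⟨b, rfl⟩ := Int.le.dest hj
  exact hJ i j h a b

theorem border_eq_coe {j n : ℤ} (h : ∀ i, (i, j) ∈ J ↔ n ≤ i) :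
    border J j = ((n : ℝ) : EReal) := by
  refine le_antisymm (iInf₂_le n ((h n).mpr le_rfl)) (le_iInf₂ fun i hi => ?_)
  exact EReal.coe_le_coe_iff.mpr (by exact_mod_cast (h i).mp hi)

theorem border_eq_top_iff {j : ℤ} : border J j = ⊤ ↔ ∀ i, (i, j) ∉ J := by
  simp only [border, iInf_eq_top]
  exact ⟨fun h i hi => EReal.coe_ne_top _ (h i hi), fun h i hi => absurd hi (h i)⟩

theorem border_eq_bot_of_forall {j : ℤ} (h : ∀ i, (i, j) ∈ J) : border J j = ⊥ := by
  rw [EReal.eq_bot_iff_forall_lt]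
  intro y
  obtain ⟨i, hi⟩ := exists_int_lt y
  exact (iInf₂_le i (h i)).trans_lt (EReal.coe_lt_coe_iff.mpr hi)

theorem IsDiagram.exists_isBorder (hJ : IsDiagram J) :
    ∃ (F : Set ℤ) (m : ℤ → ℤ), IsBorder J F m := by
  classical
  let F : Set ℤ := {j | ∃ n, ∀ i, (i, j) ∈ J ↔ n ≤ i}
  refine ⟨F, fun j => if h : j ∈ F then h.choose else 0, fun j hj i => ?_, fun j hj => ?_⟩
  · rw [dif_pos hj]; exact hj.choose_spec i
  · by_contra! hcon
    obtain ⟨⟨a, ha⟩, b, hb⟩ := hcon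
    have hbdd : ∀ i, (i, j) ∈ J → a ≤ i := fun i hi => by
      by_contra! hlt
      exact ha (hJ.mem_of_le hi hlt.le le_rfl)
    obtain ⟨n, hn, hmin⟩ := Int.exists_least_of_bdd ⟨a, hbdd⟩ ⟨b, hb⟩
    exact hj ⟨n, fun i => ⟨hmin i, fun h => hJ.mem_of_le hn h le_rfl⟩⟩

namespace IsBorder

theorem border_eq (hb : IsBorder J F m) {j : ℤ} (hj : j ∈ F) :
    border J j = ((m j : ℝ) : EReal) :=
  border_eq_coe (hb.mem_iff j hj)

theorem ne_top (hb : IsBorder J F m) {j : ℤ} (hj : j ∈ F) : border J j ≠ ⊤ := by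
  rw [hb.border_eq hj]; exact EReal.coe_ne_top _

theorem ne_bot (hb : IsBorder J F m) {j : ℤ} (hj : j ∈ F) : border J j ≠ ⊥ := by
  rw [hb.border_eq hj]; exact EReal.coe_ne_bot _

theorem mem_of_ne (hb : IsBorder J F m) {j : ℤ} (h1 : border J j ≠ ⊤) (h2 : border J j ≠ ⊥) :
    j ∈ F := by
  by_contra hj
  rcases hb.full_or_empty j hj with h | h
  · exact h2 (border_eq_bot_of_forall h)
  · exact h1 (border_eq_top_iff.mpr h)

theorem full_of_border_eq_bot (hb : IsBorder J F m) {j : ℤ} (h : border J j = ⊥) (i : ℤ) :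
    (i, j) ∈ J := by
  have hj : j ∉ F := fun hj => hb.ne_bot hj h
  refine ((hb.full_or_empty j hj).resolve_right fun he => ?_) i
  rw [border_eq_top_iff.mpr he] at h
  exact absurd h top_ne_bot

theorem mem_of_between (hb : IsBorder J F m) (hJ : IsDiagram J) {k l j : ℤ} (hk : k ∈ F)
    (hl : l ∈ F) (h1 : k ≤ j) (h2 : j ≤ l) : j ∈ F := by
  by_contra hj
  rcases hb.full_or_empty j hj with h | h
  · have := (hb.mem_iff l hl _).mp (hJ.mem_of_le (h (m l - 1)) le_rfl h2)
    omega
  · exact h (m k) (hJ.mem_of_le ((hb.mem_iff k hk _).mpr le_rfl) le_rfl h1)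

theorem mem_of_le_of_ne_top (hb : IsBorder J F m) (hJ : IsDiagram J) (h : ∀ j, border J j ≠ ⊤)
    {k j : ℤ} (hk : k ∈ F) (hjk : j ≤ k) : j ∈ F := by
  refine hb.mem_of_ne (h j) fun hbot => ?_
  have := (hb.mem_iff k hk _).mp
    (hJ.mem_of_le (hb.full_of_border_eq_bot hbot (m k - 1)) le_rfl hjk)
  omega

theorem mem_of_ge_of_ne_bot (hb : IsBorder J F m) (hJ : IsDiagram J) (h : ∀ j, border J j ≠ ⊥)
    {k j : ℤ} (hk : k ∈ F) (hkj : k ≤ j) : j ∈ F :=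
  hb.mem_of_ne (fun htop => border_eq_top_iff.mp htop (m k)
    (hJ.mem_of_le ((hb.mem_iff k hk _).mpr le_rfl) le_rfl hkj)) (h j)

end IsBorder

theorem exists_mem_and_pred_notMem {P : ℤ → Prop} (hP : ∀ a b, a ≤ b → P a → P b) {a b : ℤ}
    (ha : ¬ P a) (hb : P b) : ∃ j, P j ∧ ¬ P (j - 1) := by
  have hbdd : ∀ z, P z → a ≤ z := fun z hz => by
    by_contra! h
    exact ha (hP z a h.le hz)
  obtain ⟨j, hj, hmin⟩ := Int.exists_least_of_bdd ⟨a, hbdd⟩ ⟨b, hb⟩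
  refine ⟨j, hj, fun h => ?_⟩
  have := hmin _ h
  omega

/-- Without half-line rows every row is full or empty, so J would be ℤ² or a translate of ℤ × ℤ₊. -/
theorem IsBorder.nonempty (hb : IsBorder J F m) (hJ : IsDiagram J) (hne : J.Nonempty)
    (hns : ¬ IsSimpleDiagram J) : F.Nonempty := by
  by_contra hF
  rw [Set.not_nonempty_iff_eq_empty] at hF
  have hrow (j : ℤ) : (∀ i, (i, j) ∈ J) ∨ ∀ i, (i, j) ∉ J := hb.full_or_empty j (by simp [hF])
  have hiff (i j : ℤ) : (i, j) ∈ J ↔ (0, j) ∈ J := by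
    rcases hrow j with h | h
    · simp [h]
    · simp [h]
  obtain ⟨⟨i₀, j₀⟩, h₀⟩ := hne
  by_cases hall : ∀ j, (0, j) ∈ J
  · refine hns (Or.inl ⟨(0, 0), ?_⟩)
    ext ⟨i, j⟩
    simp [hiff i j, hall]
  · push Not at hall
    obtain ⟨a, ha⟩ := hall
    obtain ⟨j, hj, hj'⟩ := exists_mem_and_pred_notMem (P := fun j => ((0 : ℤ), j) ∈ J)
      (fun a b hab h => hJ.mem_of_le h le_rfl hab) ha ((hiff i₀ j₀).mp h₀)
    -- The translation is by j - 1 because ℤ₊ starts at 1.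
    refine hns (Or.inr (Or.inr (Or.inr ⟨(0, j - 1), ?_⟩)))
    ext ⟨i, l⟩
    rw [hiff]
    constructor
    · intro hl
      refine ⟨(i, l - (j - 1)), ⟨mem_univ _, ?_⟩, ?_⟩
      · show 0 < l - (j - 1)
        by_contra! hle
        exact hj' (hJ.mem_of_le hl le_rfl (by omega))
      · simp
    · rintro ⟨⟨a, c⟩, ⟨-, hc⟩, he⟩
      simp only [Prod.mk_add_mk, Prod.mk.injEq, mem_Ioi] at he hc
      exact hJ.mem_of_le hj le_rfl (by omega)

theorem IsBorder.isSimple_of_const (hb : IsBorder J F m) (hF : ∀ j, j ∈ F)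
    (hm : ∀ j, m j = m (j + 1)) : IsSimpleDiagram J := by
  have hc (j : ℤ) : m j = m 0 := by
    induction j using Int.inductionOn' (b := 0) with
    | zero => rfl
    | succ k _ h => rw [← hm, h]
    | pred k _ h => rw [hm, sub_add_cancel, h]
  refine Or.inr (Or.inr (Or.inl ⟨(m 0 - 1, 0), ?_⟩))
  ext ⟨i, j⟩
  rw [hb.mem_iff j (hF j), hc]
  constructor
  · intro h
    refine ⟨(i - (m 0 - 1), j), ⟨?_, mem_univ _⟩, by simp⟩
    show 0 < i - (m 0 - 1)
    omega
  · rintro ⟨⟨a, c⟩, ⟨ha, -⟩, he⟩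
    simp only [Prod.mk_add_mk, Prod.mk.injEq, mem_Ioi] at he ha
    omega

end Rows

/-! ### The parameters of a diagram -/

section Parameters

open IsSlopeCocycle

variable {J : Set (ℤ × ℤ)} {F : Set ℤ} {m : ℤ → ℤ}

theorem IsBorder.antitone' (hb : IsBorder J F m) (hJ : IsDiagram J) {j k : ℤ} (hj : j ∈ F)
    (hk : k ∈ F) (h : j ≤ k) : m k ≤ m j := by
  obtain ⟨n, rfl⟩ := Int.le.dest h
  exact hb.antitone hJ hj hk

theorem IsBorder.isSlopeCocycle_minus (hb : IsBorder J F m) (hJ : IsDiagram J) (hF : F.Nonempty)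
    (h : ∀ j, border J j ≠ ⊤) :
    IsSlopeCocycle {j | j ≤ 0 ∧ j ∈ F} (-1) (fun j n => (m (j - n) : ℝ) - m j) where
  nonempty := by
    obtain ⟨k, hk⟩ := hF
    exact ⟨min k 0, min_le_right _ _, hb.mem_of_le_of_ne_top hJ h hk (min_le_left _ _)⟩
  step := fun j hj n => ⟨by have := hj.1; omega, hb.mem_of_le_of_ne_top hJ h hj.2 (by omega)⟩
  add := fun j hj a b => by
    have e1 : j - ((a + b : ℕ) : ℤ) = j - a - b := by push_cast; ring
    have e2 : j + -1 * (a : ℤ) = j - a := by ring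
    simp only [e1, e2]; ring
  nonneg := fun j hj n => by
    rw [sub_nonneg]
    exact_mod_cast hb.antitone' hJ (hb.mem_of_le_of_ne_top hJ h hj.2 (by omega)) hj.2 (by omega)

theorem IsBorder.isSlopeCocycle_plus (hb : IsBorder J F m) (hJ : IsDiagram J) (hF : F.Nonempty)
    (h : ∀ j, border J j ≠ ⊥) :
    IsSlopeCocycle {j | -1 ≤ j ∧ j ∈ F} 1 (fun j n => (m j : ℝ) - m (j + n)) where
  nonempty := by
    obtain ⟨k, hk⟩ := hF
    exact ⟨max k (-1), le_max_right _ _, hb.mem_of_ge_of_ne_bot hJ h hk (le_max_left _ _)⟩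
  step := fun j hj n => ⟨by have := hj.1; omega, hb.mem_of_ge_of_ne_bot hJ h hj.2 (by omega)⟩
  add := fun j hj a b => by
    have e1 : j + ((a + b : ℕ) : ℤ) = j + a + b := by push_cast; ring
    have e2 : j + 1 * (a : ℤ) = j + a := by ring
    simp only [e1, e2]; ring
  nonneg := fun j hj n => by
    rw [sub_nonneg]
    exact_mod_cast hb.antitone' hJ hj.2 (hb.mem_of_ge_of_ne_bot hJ h hj.2 (by omega)) (by omega)

theorem IsBorder.slopeMinus_eq (hb : IsBorder J F m) (hJ : IsDiagram J)
    (h : ∀ j, border J j ≠ ⊤) {j : ℤ} (hj : j ∈ F) (n : ℕ) :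
    (border J (j - n) - border J j) / (n : EReal)
      = ((((m (j - n) : ℝ) - m j) / n : ℝ) : EReal) := by
  rw [hb.border_eq hj, hb.border_eq (hb.mem_of_le_of_ne_top hJ h hj (by omega))]
  rw [EReal.coe_div, EReal.coe_sub]; rfl

theorem IsBorder.slopePlus_eq (hb : IsBorder J F m) (hJ : IsDiagram J)
    (h : ∀ j, border J j ≠ ⊥) {j : ℤ} (hj : j ∈ F) (n : ℕ) :
    (border J j - border J (j + n)) / (n : EReal)
      = ((((m j : ℝ) - m (j + n)) / n : ℝ) : EReal) := by
  rw [hb.border_eq hj, hb.border_eq (hb.mem_of_ge_of_ne_bot hJ h hj (by omega))]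
  rw [EReal.coe_div, EReal.coe_sub]; rfl

theorem IsBorder.minus_iff (hb : IsBorder J F m) (h : ∀ j, border J j ≠ ⊤) (j : ℤ) :
    (j ≤ 0 ∧ border J j ≠ ⊥) ↔ j ∈ {j : ℤ | j ≤ 0 ∧ j ∈ F} :=
  ⟨fun hj => ⟨hj.1, hb.mem_of_ne (h j) hj.2⟩, fun hj => ⟨hj.1, hb.ne_bot hj.2⟩⟩

theorem IsBorder.plus_iff (hb : IsBorder J F m) (h : ∀ j, border J j ≠ ⊥) (j : ℤ) :
    (-1 ≤ j ∧ border J j ≠ ⊤) ↔ j ∈ {j : ℤ | -1 ≤ j ∧ j ∈ F} :=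
  ⟨fun hj => ⟨hj.1, hb.mem_of_ne hj.2 (h j)⟩, fun hj => ⟨hj.1, hb.ne_top hj.2⟩⟩

theorem IsBorder.rates_minus (hb : IsBorder J F m) (hJ : IsDiagram J) (hF : F.Nonempty)
    (h : ∀ j, border J j ≠ ⊤) :
    Tendsto (supSlopeMinus J) atTop (𝓝 (rhoMinus J)) ∧
    Tendsto (infSlopeMinus J) atTop (𝓝 (deltaMinus J)) ∧
    HasRates {j | j ≤ 0 ∧ j ∈ F} (fun j n => (m (j - n) : ℝ) - m j)
      (rhoMinus J) (deltaMinus J) := by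
  have hc := hb.isSlopeCocycle_minus hJ hF h
  have e1 : supSlopeMinus J = fun n : ℕ => ⨆ j ∈ {j : ℤ | j ≤ 0 ∧ j ∈ F},
      ((((m (j - n) : ℝ) - m j) / n : ℝ) : EReal) := by
    funext n
    exact iSup_congr fun j => iSup_congr_Prop (hb.minus_iff h j)
      fun hj => hb.slopeMinus_eq hJ h hj.2 n
  have e2 : infSlopeMinus J = fun n : ℕ => ⨅ j ∈ {j : ℤ | j ≤ 0 ∧ j ∈ F},
      ((((m (j - n) : ℝ) - m j) / n : ℝ) : EReal) := by
    funext n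
    exact iInf_congr fun j => iInf_congr_Prop (hb.minus_iff h j)
      fun hj => hb.slopeMinus_eq hJ h hj.2 n
  have h1 := hc.tendsto_iSup
  have h2 := hc.tendsto_iInf
  rw [← e1] at h1
  rw [← e2] at h2
  have hn : ¬ ∃ j, border J j = ⊤ := fun ⟨j, hj⟩ => h j hj
  have e3 := h1.limUnder_eq
  have e4 := h2.limUnder_eq
  rw [rhoMinus, deltaMinus, if_neg hn, if_neg hn, e3, e4]
  exact ⟨h1, h2, hc.hasRates⟩

theorem IsBorder.rates_plus (hb : IsBorder J F m) (hJ : IsDiagram J) (hF : F.Nonempty)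
    (h : ∀ j, border J j ≠ ⊥) :
    Tendsto (supSlopePlus J) atTop (𝓝 (rhoPlus J)) ∧
    Tendsto (infSlopePlus J) atTop (𝓝 (deltaPlus J)) ∧
    HasRates {j | -1 ≤ j ∧ j ∈ F} (fun j n => (m j : ℝ) - m (j + n))
      (rhoPlus J) (deltaPlus J) := by
  have hc := hb.isSlopeCocycle_plus hJ hF h
  have e1 : supSlopePlus J = fun n : ℕ => ⨆ j ∈ {j : ℤ | -1 ≤ j ∧ j ∈ F},
      ((((m j : ℝ) - m (j + n)) / n : ℝ) : EReal) := by
    funext n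
    exact iSup_congr fun j => iSup_congr_Prop (hb.plus_iff h j)
      fun hj => hb.slopePlus_eq hJ h hj.2 n
  have e2 : infSlopePlus J = fun n : ℕ => ⨅ j ∈ {j : ℤ | -1 ≤ j ∧ j ∈ F},
      ((((m j : ℝ) - m (j + n)) / n : ℝ) : EReal) := by
    funext n
    exact iInf_congr fun j => iInf_congr_Prop (hb.plus_iff h j)
      fun hj => hb.slopePlus_eq hJ h hj.2 n
  have h1 := hc.tendsto_iSup
  have h2 := hc.tendsto_iInf
  rw [← e1] at h1
  rw [← e2] at h2
  have hn : ¬ ∃ j, border J j = ⊥ := fun ⟨j, hj⟩ => h j hj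
  have e3 := h1.limUnder_eq
  have e4 := h2.limUnder_eq
  rw [rhoPlus, deltaPlus, if_neg hn, if_neg hn, e3, e4]
  exact ⟨h1, h2, hc.hasRates⟩

theorem rho_delta_minus_of_top (h : ¬ ∀ j, border J j ≠ ⊤) :
    rhoMinus J = ⊤ ∧ deltaMinus J = ⊤ := by
  have h' : ∃ j, border J j = ⊤ := by simpa using h
  exact ⟨if_pos h', if_pos h'⟩

theorem rho_delta_plus_of_bot (h : ¬ ∀ j, border J j ≠ ⊥) :
    rhoPlus J = ⊤ ∧ deltaPlus J = ⊤ := by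
  have h' : ∃ j, border J j = ⊥ := by simpa using h
  exact ⟨if_pos h', if_pos h'⟩

theorem IsBorder.nonneg_minus (hb : IsBorder J F m) (hJ : IsDiagram J) (hF : F.Nonempty) :
    0 ≤ rhoMinus J ∧ 0 ≤ deltaMinus J := by
  by_cases h : ∀ j, border J j ≠ ⊤
  · have := (hb.rates_minus hJ hF h).2.2
    exact ⟨this.nonneg_upper, this.nonneg_lower⟩
  · rw [(rho_delta_minus_of_top h).1, (rho_delta_minus_of_top h).2]
    exact ⟨le_top, le_top⟩

theorem IsBorder.nonneg_plus (hb : IsBorder J F m) (hJ : IsDiagram J) (hF : F.Nonempty) :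
    0 ≤ rhoPlus J ∧ 0 ≤ deltaPlus J := by
  by_cases h : ∀ j, border J j ≠ ⊥
  · have := (hb.rates_plus hJ hF h).2.2
    exact ⟨this.nonneg_upper, this.nonneg_lower⟩
  · rw [(rho_delta_plus_of_bot h).1, (rho_delta_plus_of_bot h).2]
    exact ⟨le_top, le_top⟩

theorem IsBorder.rho_le (hb : IsBorder J F m) (hJ : IsDiagram J) (hF : ∀ j, j ∈ F) {n : ℕ}
    (hn : 1 ≤ n) {a : ℝ} (ha : ∀ j : ℤ, (m j : ℝ) - m (j + n) ≤ a) :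
    max (rhoMinus J) (rhoPlus J) ≤ ((a / n : ℝ) : EReal) := by
  refine max_le ?_ ?_
  · refine (hb.rates_minus hJ ⟨0, hF 0⟩ fun j => hb.ne_top (hF j)).2.2.upper_le hn fun j _ => ?_
    simpa using ha (j - n)
  · exact (hb.rates_plus hJ ⟨0, hF 0⟩ fun j => hb.ne_bot (hF j)).2.2.upper_le hn fun j _ => ha j

/-- A finite bound excludes empty and full rows. Windows on one side of row 0 are covered by ρ₋ or
ρ₊; a window across it is split there, and the two constants add. -/
theorem IsBorder.of_rho_lt (hb : IsBorder J F m) (hJ : IsDiagram J) (hF : F.Nonempty) {r : ℝ}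
    (hr : max (rhoMinus J) (rhoPlus J) < r) :
    (∀ j, j ∈ F) ∧ ∃ K ≥ 0, ∀ (n : ℕ) (j : ℤ), (m j : ℝ) - m (j + n) ≤ r * n + K := by
  obtain ⟨hr1, hr2⟩ := max_lt_iff.mp hr
  have htop : ∀ j, border J j ≠ ⊤ := by
    by_contra h
    rw [(rho_delta_minus_of_top h).1] at hr1
    exact not_top_lt hr1
  have hbot : ∀ j, border J j ≠ ⊥ := by
    by_contra h
    rw [(rho_delta_plus_of_bot h).1] at hr2
    exact not_top_lt hr2
  have hall (j) : j ∈ F := hb.mem_of_ne (htop j) (hbot j)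
  obtain ⟨K₁, hK₁, h₁⟩ := (hb.rates_minus hJ hF htop).2.2.of_upper_lt hr1
  obtain ⟨K₂, hK₂, h₂⟩ := (hb.rates_plus hJ hF hbot).2.2.of_upper_lt hr2
  refine ⟨hall, K₁ + K₂, by positivity, fun n j => ?_⟩
  rcases le_or_gt 0 j with hj | hj
  · have := h₂ n j ⟨by omega, hall j⟩
    linarith
  rcases le_or_gt (j + n) 0 with hjn | hjn
  · have := h₁ n (j + n) ⟨hjn, hall _⟩
    simp only [add_sub_cancel_right] at this
    linarith
  · obtain ⟨a, rfl⟩ : ∃ a : ℕ, j = -a := ⟨(-j).toNat, by omega⟩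
    obtain ⟨b, rfl⟩ : ∃ b : ℕ, n = a + b := ⟨n - a, by omega⟩
    have h3 := h₁ a 0 ⟨le_rfl, hall _⟩
    have h4 := h₂ b 0 ⟨by omega, hall _⟩
    have e : -(a : ℤ) + ((a + b : ℕ) : ℤ) = 0 + b := by push_cast; ring
    rw [zero_sub] at h3
    rw [e]
    push_cast
    linarith

theorem IsBorder.le_delta (hb : IsBorder J F m) (hJ : IsDiagram J) (hF : F.Nonempty) {n : ℕ}
    (hn : 1 ≤ n) {b : ℝ} (hle : ∀ j : ℤ, j ∈ F → j + n ∈ F → b ≤ (m j : ℝ) - m (j + n)) :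
    ((b / n : ℝ) : EReal) ≤ min (deltaMinus J) (deltaPlus J) := by
  refine le_min ?_ ?_
  · by_cases h : ∀ j, border J j ≠ ⊤
    · refine (hb.rates_minus hJ hF h).2.2.le_lower hn fun j hj => ?_
      simpa using hle (j - n) (hb.mem_of_le_of_ne_top hJ h hj.2 (by omega)) (by simpa using hj.2)
    · rw [(rho_delta_minus_of_top h).2]; exact le_top
  · by_cases h : ∀ j, border J j ≠ ⊥
    · exact (hb.rates_plus hJ hF h).2.2.le_lower hn fun j hj =>
        hle j hj.2 (hb.mem_of_ge_of_ne_bot hJ h hj.2 (by omega))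
    · rw [(rho_delta_plus_of_bot h).2]; exact le_top

/-- Speaking of cells instead of border values also covers δ₊ = ∞, where rows may be full. -/
theorem IsBorder.of_lt_deltaPlus (hb : IsBorder J F m) (hJ : IsDiagram J) (hF : F.Nonempty)
    {r : ℝ} (hr0 : 0 ≤ r) (hr : r < deltaPlus J) :
    ∃ K ≥ 0, ∀ (n : ℕ) (i j i' : ℤ), 0 ≤ j → (i, j) ∈ J → (i : ℝ) - (r * n - K) ≤ i' →
      (i', j + n) ∈ J := by
  by_cases h : ∀ j, border J j ≠ ⊥
  · obtain ⟨K, hK, hD⟩ := (hb.rates_plus hJ hF h).2.2.of_lt_lower hr0 hr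
    refine ⟨K, hK, fun n i j i' hj hij hi' => ?_⟩
    have hjF : j ∈ F := hb.mem_of_ne (fun htop => border_eq_top_iff.mp htop i hij) (h j)
    have h1 := hD n j ⟨by omega, hjF⟩
    have h2 : (m j : ℝ) ≤ i := by exact_mod_cast (hb.mem_iff j hjF i).mp hij
    rw [hb.mem_iff _ (hb.mem_of_ge_of_ne_bot hJ h hjF (by omega))]
    have : (m (j + n) : ℝ) ≤ i' := by linarith
    exact_mod_cast this
  · push Not at h
    obtain ⟨l, hl⟩ := h
    -- Row l is full. Windows of length at least |l| end in a full row; for shorter ones r n - K ≤ 0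
    -- and the diagram property suffices.
    refine ⟨r * l.natAbs, by positivity, fun n i j i' hj hij hi' => ?_⟩
    rcases le_total l.natAbs n with hn | hn
    · exact hJ.mem_of_le (hb.full_of_border_eq_bot hl i') le_rfl (by omega)
    · have h1 : r * (n : ℝ) ≤ r * l.natAbs := by gcongr
      have h2 : (i : ℝ) ≤ i' := by linarith
      exact hJ.mem_of_le hij (by exact_mod_cast h2) (by omega)

theorem IsBorder.of_lt_deltaMinus (hb : IsBorder J F m) (hJ : IsDiagram J) (hF : F.Nonempty)
    {r : ℝ} (hr0 : 0 ≤ r) (hr : r < deltaMinus J) :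
    ∃ K ≥ 0, ∀ (n : ℕ) (i j i' : ℤ), j + n ≤ 0 → (i, j) ∈ J → (i : ℝ) - (r * n - K) ≤ i' →
      (i', j + n) ∈ J := by
  by_cases h : ∀ j, border J j ≠ ⊤
  · obtain ⟨K, hK, hD⟩ := (hb.rates_minus hJ hF h).2.2.of_lt_lower hr0 hr
    refine ⟨K, hK, fun n i j i' hj hij hi' => ?_⟩
    by_cases hjF : j + n ∈ F
    · have hjF' : j ∈ F := hb.mem_of_le_of_ne_top hJ h hjF (by omega)
      have h1 := hD n (j + n) ⟨hj, hjF⟩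
      rw [add_sub_cancel_right] at h1
      have h2 : (m j : ℝ) ≤ i := by exact_mod_cast (hb.mem_iff j hjF' i).mp hij
      rw [hb.mem_iff _ hjF]
      have : (m (j + n) : ℝ) ≤ i' := by linarith
      exact_mod_cast this
    · exact (hb.full_or_empty _ hjF).resolve_right
        (fun he => h _ (border_eq_top_iff.mpr he)) i'
  · push Not at h
    obtain ⟨l, hl⟩ := h
    refine ⟨r * l.natAbs, by positivity, fun n i j i' hj hij hi' => ?_⟩
    rcases le_total l.natAbs n with hn | hn
    · exact absurd (hJ.mem_of_le hij le_rfl (by omega)) (border_eq_top_iff.mp hl i)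
    · have h1 : r * (n : ℝ) ≤ r * l.natAbs := by gcongr
      have h2 : (i : ℝ) ≤ i' := by linarith
      exact hJ.mem_of_le hij (by exact_mod_cast h2) (by omega)

theorem IsBorder.of_lt_delta (hb : IsBorder J F m) (hJ : IsDiagram J) (hF : F.Nonempty)
    {r : ℝ} (hr0 : 0 ≤ r) (hr : r < min (deltaMinus J) (deltaPlus J)) :
    ∃ K ≥ 0, ∀ (n : ℕ) (i j i' : ℤ), (i, j) ∈ J → (i : ℝ) - (r * n - K) ≤ i' →
      (i', j + n) ∈ J := by
  obtain ⟨hr1, hr2⟩ := lt_min_iff.mp hr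
  obtain ⟨K₁, hK₁, h₁⟩ := hb.of_lt_deltaMinus hJ hF hr0 hr1
  obtain ⟨K₂, hK₂, h₂⟩ := hb.of_lt_deltaPlus hJ hF hr0 hr2
  -- The extra 1 pays for rounding to an integer cell in row 0, where a crossing window is split.
  refine ⟨K₁ + K₂ + 1, by positivity, fun n i j i' hij hi' => ?_⟩
  rcases le_or_gt 0 j with hj | hj
  · exact h₂ n i j i' hj hij (by linarith)
  rcases le_or_gt (j + n) 0 with hjn | hjn
  · exact h₁ n i j i' hjn hij (by linarith)
  · obtain ⟨a, rfl⟩ : ∃ a : ℕ, j = -a := ⟨(-j).toNat, by omega⟩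
    obtain ⟨b, rfl⟩ : ∃ b : ℕ, n = a + b := ⟨n - a, by omega⟩
    have h3 := h₁ a i (-a) ⌈(i : ℝ) - (r * a - K₁)⌉ (by omega) hij (Int.le_ceil _)
    rw [neg_add_cancel] at h3
    have h4 := h₂ b _ 0 i' le_rfl h3 (by
      have := Int.ceil_lt_add_one ((i : ℝ) - (r * a - K₁))
      push_cast at hi'
      linarith)
    have e : -(a : ℤ) + ((a + b : ℕ) : ℤ) = 0 + b := by push_cast; ring
    rwa [e]

/-- An empty row below, or a full row above a half-line, yields an infinite edge. Otherwise all rows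
are half-lines, and if no edge had length N the one-step drops would be bounded and ρ₋, ρ₊ finite.
-/
theorem IsBorder.exists_long_edge (hb : IsBorder J F m) (hJ : IsDiagram J) (hne : J.Nonempty)
    (hF : F.Nonempty) (h : max (rhoMinus J) (rhoPlus J) = ⊤) (N : ℕ) :
    ∃ i j : ℤ, ∀ t < N, (i + (t : ℕ), j) ∈ J ∧ (i + (t : ℕ), j - 1) ∉ J := by
  by_contra hcon
  have htop : ∀ j, border J j ≠ ⊤ := by
    intro l hl
    obtain ⟨⟨i₀, j₀⟩, h₀⟩ := hne
    obtain ⟨j, ⟨i, hi⟩, hj⟩ := exists_mem_and_pred_notMem (P := fun j => ∃ i, (i, j) ∈ J)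
      (fun a b hab ⟨i, hi⟩ => ⟨i, hJ.mem_of_le hi le_rfl hab⟩) (a := l) (b := j₀)
      (fun ⟨i, hi⟩ => border_eq_top_iff.mp hl i hi) ⟨i₀, h₀⟩
    exact hcon ⟨i, j, fun t _ => ⟨hJ.mem_of_le hi (by omega) le_rfl, fun h => hj ⟨_, h⟩⟩⟩
  have hbot : ∀ j, border J j ≠ ⊥ := by
    intro l hl
    obtain ⟨k, hk⟩ := hF
    obtain ⟨j, hj, hj'⟩ := exists_mem_and_pred_notMem (P := fun j => ∀ i, (i, j) ∈ J)
      (fun a b hab h i => hJ.mem_of_le (h i) le_rfl hab) (a := k) (b := l)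
      (fun h => by have := (hb.mem_iff k hk _).mp (h (m k - 1)); omega)
      (hb.full_of_border_eq_bot hl)
    push Not at hj'
    obtain ⟨i, hi⟩ := hj'
    exact hcon ⟨i - N, j, fun t ht => ⟨hj _, fun h => hi (hJ.mem_of_le h (by omega) le_rfl)⟩⟩
  have hall (j) : j ∈ F := hb.mem_of_ne (htop j) (hbot j)
  have hle := hb.rho_le hJ hall (n := 1) le_rfl (a := N) fun j => by
    by_contra! hlt
    have hlt' : (N : ℤ) < m j - m (j + 1) := by exact_mod_cast hlt
    refine hcon ⟨m (j + 1), j + 1, fun t ht => ⟨?_, ?_⟩⟩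
    · rw [hb.mem_iff _ (hall _)]; omega
    · rw [add_sub_cancel_right, hb.mem_iff _ (hall _)]; omega
  rw [h] at hle
  exact EReal.coe_ne_top _ (top_le_iff.mp hle)

end Parameters

/-! ### The Taylor spectrum -/

section Spectrum

variable {J : Set (ℤ × ℤ)} {F : Set ℤ} {m : ℤ → ℤ} {μ lam : ℂ}

/-- The failure is strict, so by continuity the exponent can be enlarged to a real r > ρ; this
leaves room for the additive error in the slopes. -/
theorem exists_real_of_not_powLE {x y : ℝ} (hx : 0 ≤ x) (hy : 0 ≤ y) {ρ : EReal} (hρ : 0 ≤ ρ)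
    (h : ¬ PowLE x ρ y) : 0 < x ∧ ∃ r : ℝ, 0 < r ∧ ρ < r ∧ y < x ^ r := by
  simp only [PowLE, IsIndeterminate, not_or, not_le] at h
  obtain ⟨⟨h0, -⟩, h⟩ := h
  have htop : ρ ≠ ⊤ := by
    intro ht
    rw [extPow, if_pos ht] at h
    exact absurd h (not_lt.mpr hy)
  rw [extPow, if_neg htop] at h
  lift ρ to ℝ using ⟨htop, ne_bot_of_le_ne_bot (by simp) hρ⟩
  rw [EReal.toReal_coe] at h
  rw [EReal.coe_nonneg] at hρ
  have hx0 : 0 < x := by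
    refine lt_of_le_of_ne hx fun hx' => ?_
    subst hx'
    have hne : ρ ≠ 0 := fun hρ0 => h0 ⟨rfl, by rw [hρ0]; rfl⟩
    rw [Real.zero_rpow hne] at h
    exact absurd h (not_lt.mpr hy)
  have hcont : Tendsto (fun r : ℝ => x ^ r) (𝓝[>] ρ) (𝓝 (x ^ ρ)) :=
    (Real.continuousAt_const_rpow hx0.ne').tendsto.mono_left nhdsWithin_le_nhds
  obtain ⟨r, hr1, hr2⟩ := ((hcont.eventually (lt_mem_nhds h)).and self_mem_nhdsWithin).exists
  exact ⟨hx0, r, hρ.trans_lt hr2, EReal.coe_lt_coe_iff.mpr hr2, hr1⟩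

/-- Here the exponent is lowered. The base is replaced by x' ∈ [x, 1), positive even when x = 0, so
that real powers can be added and cancelled. -/
theorem exists_real_of_not_LEPow {x y : ℝ} (hx : 0 ≤ x) (hx1 : x ≤ 1) (hy1 : y ≤ 1)
    {δ : EReal} (hδ : 0 ≤ δ) (h : ¬ LEPow y x δ) :
    ∃ (r x' : ℝ), 0 < r ∧ r < δ ∧ 0 < x' ∧ x' < 1 ∧ x ≤ x' ∧ x' ^ r < y := by
  simp only [LEPow, IsIndeterminate, not_or, not_le] at h
  obtain ⟨⟨h0, h1⟩, h⟩ := h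
  have hy : 0 < y := by
    refine lt_of_le_of_lt ?_ h
    rw [extPow]; split_ifs
    · exact le_rfl
    · exact Real.rpow_nonneg hx _
  rcases hx.eq_or_lt with rfl | hx0
  · have hδ0 : 0 < δ := lt_of_le_of_ne hδ fun h' => h0 ⟨rfl, h'.symm⟩
    obtain ⟨r, hr1, hr2⟩ := EReal.lt_iff_exists_real_btwn.mp hδ0
    have hr0 : 0 < r := EReal.coe_pos.mp hr1
    refine ⟨r, (y / 2) ^ (1 / r), hr0, hr2, by positivity, ?_, by positivity, ?_⟩
    · exact Real.rpow_lt_one (by positivity) (by linarith) (by positivity)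
    · rw [← Real.rpow_mul (by positivity), one_div_mul_cancel hr0.ne', Real.rpow_one]; linarith
  · by_cases htop : δ = ⊤
    · have hx1' : x < 1 := lt_of_le_of_ne hx1 fun hx' => h1 ⟨hx', htop⟩
      obtain ⟨n, hn⟩ := exists_pow_lt_of_lt_one hy hx1'
      refine ⟨n + 1, x, by positivity, by rw [htop]; exact EReal.coe_lt_top _, hx0, hx1', le_rfl, ?_⟩
      refine lt_of_le_of_lt ?_ hn
      rw [← Real.rpow_natCast]
      exact Real.rpow_le_rpow_of_exponent_ge hx0 hx1 (by linarith)
    · rw [extPow, if_neg htop] at h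
      lift δ to ℝ using ⟨htop, ne_bot_of_le_ne_bot (by simp) hδ⟩
      rw [EReal.toReal_coe] at h
      rw [EReal.coe_nonneg] at hδ
      have hx1' : x < 1 := by
        refine lt_of_le_of_ne hx1 fun hx' => ?_
        rw [hx', Real.one_rpow] at h
        linarith
      have hδ0 : 0 < δ := by
        refine lt_of_le_of_ne hδ fun hδ' => ?_
        rw [← hδ', Real.rpow_zero] at h
        linarith
      have hcont : Tendsto (fun r : ℝ => x ^ r) (𝓝[<] δ) (𝓝 (x ^ δ)) :=
        (Real.continuousAt_const_rpow hx0.ne').tendsto.mono_left nhdsWithin_le_nhds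
      obtain ⟨r, hr1, hr2, hr3⟩ := ((hcont.eventually (gt_mem_nhds h)).and
        (Ioo_mem_nhdsLT hδ0)).exists
      exact ⟨r, x, hr2, EReal.coe_lt_coe_iff.mpr hr3, hx0, hx1', le_rfl, hr1⟩

theorem koszulExactAt_of_not_powLE (hb : IsBorder J F m) (hJ : IsDiagram J) (hF : F.Nonempty)
    (hμ : ‖μ‖ ≤ 1) (h : ¬ PowLE ‖μ‖ (max (rhoMinus J) (rhoPlus J)) ‖lam‖) :
    KoszulExactAt hJ μ lam := by
  obtain ⟨hμ0, r, hr0, hr, hlt⟩ := exists_real_of_not_powLE (norm_nonneg _) (norm_nonneg _)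
    ((hb.nonneg_minus hJ hF).1.trans (le_max_left _ _)) h
  obtain ⟨hall, K, hK, hD⟩ := hb.of_rho_lt hJ hF hr
  have hq : ‖lam‖ / ‖μ‖ ^ r < 1 := (div_lt_one (Real.rpow_pos_of_pos hμ0 r)).mpr hlt
  -- The factor |μ|^(K + 1) pays for the slope error K and for rounding r n + K up to an integer.
  obtain ⟨n, hn⟩ := exists_pow_lt_of_lt_one (Real.rpow_pos_of_pos hμ0 (K + 1)) hq
  rw [div_pow, div_lt_iff₀ (by positivity)] at hn
  refine koszulExact_of_shift_right (a := ⌈r * n + K⌉₊) (n := n) hJ (fun i j hij => ?_) ?_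
  · rw [hb.mem_iff _ (hall _)] at hij ⊢
    have h1 := hD n (j + -n)
    rw [neg_add_cancel_right] at h1
    have h2 := Nat.le_ceil (r * n + K)
    have h3 : (m j : ℝ) ≤ i := by exact_mod_cast hij
    have : (m (j + -n) : ℝ) ≤ i + ⌈r * n + K⌉₊ := by linarith
    exact_mod_cast this
  · refine hn.trans_le ?_
    rw [← Real.rpow_natCast (‖μ‖ ^ r), ← Real.rpow_mul hμ0.le, ← Real.rpow_add hμ0,
      ← Real.rpow_natCast]
    refine Real.rpow_le_rpow_of_exponent_ge hμ0 hμ ?_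
    have := Nat.ceil_lt_add_one (show 0 ≤ r * n + K by positivity)
    linarith

theorem koszulExactAt_of_not_LEPow (hb : IsBorder J F m) (hJ : IsDiagram J) (hF : F.Nonempty)
    (hμ : ‖μ‖ ≤ 1) (hlam : ‖lam‖ ≤ 1)
    (h : ¬ LEPow ‖lam‖ ‖μ‖ (min (deltaMinus J) (deltaPlus J))) :
    KoszulExactAt hJ μ lam := by
  obtain ⟨r, x, hr0, hr, hx0, hx1, hxμ, hlt⟩ := exists_real_of_not_LEPow (norm_nonneg _) hμ hlam
    (le_min (hb.nonneg_minus hJ hF).2 (hb.nonneg_plus hJ hF).2) h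
  obtain ⟨K, hK, hD⟩ := hb.of_lt_delta hJ hF hr0.le hr
  have hlam0 : 0 < ‖lam‖ := (Real.rpow_pos_of_pos hx0 r).trans hlt
  have hq : x ^ r / ‖lam‖ < 1 := (div_lt_one hlam0).mpr hlt
  -- Again K + 1 pays for the slope error and the rounding; n ≥ K / r also keeps r n - K nonnegative
  -- before it is rounded down.
  have h1 := (tendsto_pow_atTop_nhds_zero_of_lt_one (by positivity) hq).eventually
    (gt_mem_nhds (Real.rpow_pos_of_pos hx0 (K + 1)))
  obtain ⟨n, hn, hn2⟩ := (h1.and (eventually_ge_atTop ⌈K / r⌉₊)).exists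
  rw [div_pow, div_lt_iff₀ (by positivity)] at hn
  have hrn : 0 ≤ r * n - K := by
    have := Nat.ceil_le.mp hn2
    rw [div_le_iff₀ hr0] at this
    linarith
  refine koszulExact_of_shift_left (b := ⌊r * n - K⌋₊) (n := n) hJ
    (fun i j hij => hD n i j _ hij ?_) ?_
  · have := Nat.floor_le hrn
    push_cast
    linarith
  · have h2 := Nat.lt_floor_add_one (r * n - K)
    have h3 : x ^ ⌊r * n - K⌋₊ * x ^ (K + 1) ≤ (x ^ r) ^ n := by
      rw [← Real.rpow_natCast (x ^ r), ← Real.rpow_mul hx0.le, ← Real.rpow_natCast,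
        ← Real.rpow_add hx0]
      exact Real.rpow_le_rpow_of_exponent_ge hx0 hx1.le (by linarith)
    have h4 : x ^ ⌊r * n - K⌋₊ < ‖lam‖ ^ n := by
      refine lt_of_mul_lt_mul_right ?_ (Real.rpow_pos_of_pos hx0 (K + 1)).le
      rw [mul_comm (‖lam‖ ^ n)]
      exact h3.trans_lt hn
    exact lt_of_le_of_lt (by gcongr) h4

/-- Window products inside F are powers of |μ| with exponent the drop of the border. They all lie
below |λ|^n, so every drop is at least b, whence δ₋, δ₊ ≥ b/n and |μ|^δ ≤ |μ|^(b/n) < |λ| for δ =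
min(δ₋, δ₊). -/
theorem not_LEPow_of_prod_lt (hb : IsBorder J F m) (hJ : IsDiagram J) (hF : F.Nonempty)
    (hμ : ‖μ‖ < 1) (hlam : ‖lam‖ ≤ 1) (hlam0 : lam ≠ 0) {n : ℕ} (hn : 1 ≤ n)
    (h : ∀ k : ℤ, ∏ i ∈ Finset.range n, ‖shiftWeight μ F m (k + (i : ℕ))‖ < ‖lam‖ ^ n) :
    ¬ LEPow ‖lam‖ ‖μ‖ (min (deltaMinus J) (deltaPlus J)) := by
  classical
  have hpos : 0 < ‖lam‖ := norm_pos_iff.mpr hlam0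
  have hn0 : n ≠ 0 := by omega
  have hex := exists_pow_lt_of_lt_one (pow_pos hpos n) hμ
  -- Drops are integers, so the least admissible exponent keeps the inequality strict uniformly over
  -- all windows.
  set b := Nat.find hex with hbdef
  have hbs : ‖μ‖ ^ b < ‖lam‖ ^ n := Nat.find_spec hex
  have hb0 : b ≠ 0 := by
    intro h0
    rw [h0, pow_zero] at hbs
    exact absurd hbs (not_lt.mpr (pow_le_one₀ hpos.le hlam))
  have hle : (((b : ℝ) / n : ℝ) : EReal) ≤ min (deltaMinus J) (deltaPlus J) := by
    refine hb.le_delta hJ hF hn fun j hj hjn => ?_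
    have h1 := h j
    rw [prod_norm_shiftWeight hb hJ fun i hi =>
      hb.mem_of_between hJ hj hjn (by omega) (by omega)] at h1
    have h2 : b ≤ (m j - m (j + n)).toNat := Nat.find_min' hex h1
    have h3 : (b : ℤ) ≤ m j - m (j + n) := by omega
    exact_mod_cast h3
  have hbn : (0 : ℝ) < b / n := by positivity
  rintro ((⟨-, h0⟩ | ⟨h1, -⟩) | h0)
  · rw [h0] at hle
    exact absurd (EReal.coe_nonpos.mp hle) (not_le.mpr hbn)
  · exact hμ.ne h1
  · rw [extPow] at h0
    split_ifs at h0 with htop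
    · linarith
    · have h1 : (b : ℝ) / n ≤ (min (deltaMinus J) (deltaPlus J)).toReal := by
        rw [← EReal.toReal_coe ((b : ℝ) / n)]
        exact EReal.toReal_le_toReal hle (EReal.coe_ne_bot _) htop
      have h2 := h0.trans (Real.rpow_le_rpow_of_exponent_ge_of_imp (norm_nonneg μ) hμ.le h1
        fun _ h => absurd h (hbn.trans_le h1).ne')
      have h3 := pow_le_pow_left₀ hpos.le h2 n
      rw [← Real.rpow_natCast (‖μ‖ ^ _), ← Real.rpow_mul (norm_nonneg μ),
        div_mul_cancel₀ _ (by exact_mod_cast hn0), Real.rpow_natCast] at h3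
      linarith

theorem not_powLE_of_lt_prod (hb : IsBorder J F m) (hJ : IsDiagram J)
    (hns : ¬ IsSimpleDiagram J) (hμ : ‖μ‖ < 1) (hw : ∀ j, shiftWeight μ F m j ≠ 0)
    {ε : ℝ} (hε : 0 < ε) (hεw : ∀ j, ε ≤ ‖shiftWeight μ F m j‖) {n : ℕ} (hn : 1 ≤ n)
    (h : ∀ k : ℤ, ‖lam‖ ^ n < ∏ i ∈ Finset.range n, ‖shiftWeight μ F m (k + (i : ℕ))‖) :
    ¬ PowLE ‖μ‖ (max (rhoMinus J) (rhoPlus J)) ‖lam‖ := by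
  have hall (j) : j ∈ F := (shiftWeight_ne_zero (hw j)).1
  have hn0 : n ≠ 0 := by omega
  -- For μ = 0 a weight is nonzero only as 0^0; the border would be constant and J a translate of ℤ₊
  -- × ℤ.
  have hμ0 : μ ≠ 0 := by
    rintro rfl
    refine hns (hb.isSimple_of_const hall fun j => ?_)
    have h1 := hw j
    rw [shiftWeight, if_pos ⟨hall _, hall _⟩] at h1
    have h2 := hb.antitone' hJ (hall j) (hall (j + 1)) (by omega)
    by_contra hne
    exact h1 (zero_pow (by omega))
  have hpos : 0 < ‖μ‖ := norm_pos_iff.mpr hμ0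
  set D : ℤ → ℕ := fun k => (m k - m (k + n)).toNat with hD
  have hprod (k : ℤ) : ∏ i ∈ Finset.range n, ‖shiftWeight μ F m (k + (i : ℕ))‖ = ‖μ‖ ^ D k :=
    prod_norm_shiftWeight hb hJ fun i _ => hall _
  -- The lower bound on the weights bounds the drops, so a largest one is attained and the strict
  -- inequality there survives the supremum in ρ.
  have hbdd : BddAbove (range D) := by
    obtain ⟨B, hB⟩ := exists_pow_lt_of_lt_one (pow_pos hε n) hμ
    refine ⟨B, ?_⟩
    rintro _ ⟨k, rfl⟩
    by_contra! hlt
    have h1 : ε ^ n ≤ ‖μ‖ ^ D k := by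
      rw [← hprod, ← Finset.card_range n, ← Finset.prod_const, Finset.card_range]
      exact Finset.prod_le_prod (fun _ _ => hε.le) fun _ _ => hεw _
    have h2 : ‖μ‖ ^ D k ≤ ‖μ‖ ^ B := pow_le_pow_of_le_one hpos.le hμ.le hlt.le
    linarith
  obtain ⟨k₀, hk₀⟩ := Nat.sSup_mem (range_nonempty D) hbdd
  have hmax (k) : D k ≤ D k₀ := by rw [hk₀]; exact le_csSup hbdd ⟨k, rfl⟩
  have hlt : ‖lam‖ ^ n < ‖μ‖ ^ D k₀ := by rw [← hprod]; exact h k₀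
  have hle : max (rhoMinus J) (rhoPlus J) ≤ (((D k₀ : ℝ) / n : ℝ) : EReal) := by
    refine hb.rho_le hJ hall hn fun j => ?_
    have h1 := hmax j
    have h2 : m j - m (j + n) ≤ (D k₀ : ℤ) := by
      have : m j - m (j + n) ≤ (D j : ℤ) := Int.self_le_toNat _
      omega
    exact_mod_cast h2
  have htop : max (rhoMinus J) (rhoPlus J) ≠ ⊤ := fun ht => by
    rw [ht] at hle
    exact EReal.coe_ne_top _ (top_le_iff.mp hle)
  have hρ : (0 : EReal) ≤ max (rhoMinus J) (rhoPlus J) :=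
    (hb.nonneg_minus hJ ⟨0, hall 0⟩).1.trans (le_max_left _ _)
  rintro ((⟨h0, -⟩ | ⟨h1, -⟩) | h0)
  · exact hpos.ne' h0
  · exact hμ.ne h1
  · rw [extPow, if_neg htop] at h0
    have h1 : (max (rhoMinus J) (rhoPlus J)).toReal ≤ (D k₀ : ℝ) / n := by
      rw [← EReal.toReal_coe ((D k₀ : ℝ) / n)]
      exact EReal.toReal_le_toReal hle (ne_bot_of_le_ne_bot (by simp) hρ) (EReal.coe_ne_top _)
    have h2 := (Real.rpow_le_rpow_of_exponent_ge hpos hμ.le h1).trans h0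
    have h3 := pow_le_pow_left₀ (by positivity) h2 n
    rw [← Real.rpow_natCast (‖μ‖ ^ _), ← Real.rpow_mul (norm_nonneg μ),
      div_mul_cancel₀ _ (by exact_mod_cast hn0), Real.rpow_natCast] at h3
    linarith

theorem not_koszulExactAt_of_powLE_of_LEPow (hb : IsBorder J F m) (hJ : IsDiagram J)
    (hne : J.Nonempty) (hns : ¬ IsSimpleDiagram J) (hμ : ‖μ‖ ≤ 1) (hlam : ‖lam‖ ≤ 1)
    (h1 : PowLE ‖μ‖ (max (rhoMinus J) (rhoPlus J)) ‖lam‖)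
    (h2 : LEPow ‖lam‖ ‖μ‖ (min (deltaMinus J) (deltaPlus J))) : ¬ KoszulExactAt hJ μ lam := by
  have hF := hb.nonempty hJ hne hns
  rcases hμ.eq_or_lt with hμ1 | hμ1
  · rcases hlam.eq_or_lt with hlam1 | hlam1
    · exact not_koszulExactAt_of_norm_eq_one hJ hne hμ1 hlam1
    -- With |μ| = 1 > |λ| the lower inequality can hold only as the indeterminate form 1^∞.
    · have htop : max (rhoMinus J) (rhoPlus J) = ⊤ := by
        rw [hμ1] at h1
        rcases h1 with (⟨h, -⟩ | ⟨-, h⟩) | h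
        · exact absurd h one_ne_zero
        · exact h
        · by_contra hne
          rw [extPow, if_neg hne, Real.one_rpow] at h
          linarith
      exact not_koszulExactAt_of_long_edges hJ hμ1 hlam1 (hb.exists_long_edge hJ hne hF htop)
  · intro hex
    rcases hex.dichotomy hb hF hμ1 with ⟨hlam0, n, hn, h⟩ | ⟨hw, ⟨ε, hε, hεw⟩, n, hn, h⟩
    · exact not_LEPow_of_prod_lt hb hJ hF hμ1 hlam hlam0 hn h h2
    · exact not_powLE_of_lt_prod hb hJ hns hμ1 hw hε hεw hn h h1

end Spectrum

end

theorem theorem5p1 (J : Set (ℤ × ℤ)) (hJ : IsDiagram J) (hne : J.Nonempty)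
    (hns : ¬ IsSimpleDiagram J) :
    -- the limits that define the parameters exist in `[0, ∞]`
    ((∀ j, border J j ≠ ⊤) →
      Tendsto (supSlopeMinus J) atTop (𝓝 (rhoMinus J)) ∧
      Tendsto (infSlopeMinus J) atTop (𝓝 (deltaMinus J))) ∧
    ((∀ j, border J j ≠ ⊥) →
      Tendsto (supSlopePlus J) atTop (𝓝 (rhoPlus J)) ∧
      Tendsto (infSlopePlus J) atTop (𝓝 (deltaPlus J))) ∧
    (0 ≤ rhoMinus J ∧ 0 ≤ deltaMinus J ∧ 0 ≤ rhoPlus J ∧ 0 ≤ deltaPlus J) ∧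
    -- the Taylor spectrum
    taylorSpectrum (Mw hJ) (Mz hJ) (commute_Mw_Mz hJ) =
      {p : ℂ × ℂ | ‖p.1‖ ≤ 1 ∧ ‖p.2‖ ≤ 1 ∧
        PowLE ‖p.1‖ (max (rhoMinus J) (rhoPlus J)) ‖p.2‖ ∧
        LEPow ‖p.2‖ ‖p.1‖ (min (deltaMinus J) (deltaPlus J))} := by
  obtain ⟨F, m, hb⟩ := hJ.exists_isBorder
  have hF := hb.nonempty hJ hne hns
  refine ⟨fun h => ?_, fun h => ?_, ?_, ?_⟩
  · have := hb.rates_minus hJ hF h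
    exact ⟨this.1, this.2.1⟩
  · have := hb.rates_plus hJ hF h
    exact ⟨this.1, this.2.1⟩
  · have h1 := hb.nonneg_minus hJ hF
    have h2 := hb.nonneg_plus hJ hF
    exact ⟨h1.1, h1.2, h2.1, h2.2⟩
  · ext ⟨μ, lam⟩
    constructor
    · intro (h : ¬ KoszulExactAt hJ μ lam)
      have hμ : ‖μ‖ ≤ 1 := by
        by_contra! hlt; exact h (koszulExact_of_one_lt_left hJ hlt)
      have hlam : ‖lam‖ ≤ 1 := by
        by_contra! hlt; exact h (koszulExact_of_one_lt_right hJ hlt)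
      refine ⟨hμ, hlam, ?_, ?_⟩
      · by_contra hn; exact h (koszulExactAt_of_not_powLE hb hJ hF hμ hn)
      · by_contra hn; exact h (koszulExactAt_of_not_LEPow hb hJ hF hμ hlam hn)
    · rintro ⟨hμ, hlam, h1, h2⟩
      exact not_koszulExactAt_of_powLE_of_LEPow hb hJ hne hns hμ hlam h1 h2
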